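/- Let $G$ be a discrete group and let $\mathcal F$ be the family of its finite subgroups. Let $\mathcal O_{\mathcal F}G$ be the orbit category, whose objects are the $G$-sets $G/H$ with $H\in\mathcal F$ and whose morphisms are the $G$-maps. A (right) $\mathcal O_{\mathcal F}G$-module is a contravariant functor from $\mathcal O_{\mathcal F}G$ to abelian groups, and $\underline{\mathbb Z}$ denotes the constant module with value $\mathbb Z$. For an $\mathcal O_{\mathcal F}G$-module $M$, the Bredon cohomology $\mathrm H^n_{\mathcal F}(G,M)$ is the $n$-th cohomology of $\mathrm{Hom}_{\mathcal O_{\mathcal F}G}(P_*,M)$, where $P_*\to\underline{\mathbb Z}$ is a projective resolution, and $\underline{\mathrm{cd}}(G)\in\mathbb N\cup\{\infty\}$ is the smallest possible length of a projective resolution of $\underline{\mathbb Z}$. For $K\in\mathcal F$ let $P_K=\mathbb Z[-,G/K]$ be the free module sending $G/H$ to the free abelian group on the set of $G$-maps $G/H\to G/K$, let $N_K\subseteq P_K$ be the submodule generated by the values of $P_K$ at all $G/H$ such that $H\in\mathcal F$ is conjugate to a proper subgroup of $K$, and let $Q_K=P_K/N_K$ be the cokernel of the inclusion. Suppose that $G$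 admits a cocompact model for $\underline EG$, that is, a $G$-CW-complex $X$ with finite point stabilizers and compact orbit space $G\backslash X$ such that the fixed point set $X^H$ is contractible for every finite subgroup $H$ of $G$. Then $$\underline{\mathrm{cd}}(G)=\sup\{\,n\in\mathbb N \mid \mathrm H^n_{\mathcal F}(G,Q_K)\neq 0\ \text{for some } K\in\mathcal F\,\}.$$ Here the supremum is taken in $\{-\infty\}\cup\mathbb N\cup\{\infty\}$, so the statement includes that the set on the right is non-empty. -/

import Mathlib

open CategoryTheory

universe u v

/-! ### G-CW-complexes and cocompact models for the classifying space for proper actions -/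

/-- A `G`-CW-structure on a `G`-space `X`, for a discrete group `G`: a CW-structure on `X` whose
`n`-cells are indexed by a `G`-set and whose characteristic maps `D^n → X` are compatible with the
action.  Decomposing the `G`-set of `n`-cells into orbits `G/H`, this is a family of equivariant
`n`-cells `G/H × D^n → X`; the stabilizer of a cell fixes that cell pointwise. -/
structure GCWStructure (G : Type u) (X : Type v) [Group G] [TopologicalSpace X] [MulAction G X]
    extends Topology.CWComplex (Set.univ : Set X) where
  /-- the action of `G` on the set of `n`-cells -/
  cellAction (n : ℕ) : MulAction G (cell n)
  /-- the characteristic maps are equivariant -/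
  map_smul (n : ℕ) (g : G) (i : cell n) (x : Fin n → ℝ) (hx : x ∈ Metric.closedBall 0 1) :
    map n ((cellAction n).toSMul.smul g i) x = g • map n i x

/-- `X` is a cocompact model for the classifying space for proper actions of the discrete group
`G`: a Hausdorff `G`-space with a `G`-CW-structure, finite point stabilizers, contractible (in
particular non-empty) fixed point spaces `X^H` for all finite subgroups `H` of `G`, and compact
orbit space. -/
structure IsCocompactProperModel (G : Type u) (X : Type v) [Group G] [TopologicalSpace X]
    [MulAction G X] : Prop where
  t2Space : T2Space X
  continuousConstSMul : ContinuousConstSMul G X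
  gcw : Nonempty (GCWStructure G X)
  finite_stabilizer : ∀ x : X, Finite (MulAction.stabilizer G x)
  contractible_fixedPoints : ∀ H : Subgroup G, Finite H →
    ContractibleSpace (MulAction.fixedPoints H X)
  compact_quotient : CompactSpace (MulAction.orbitRel.Quotient G X)

/-! ### The orbit category and its modules -/

/-- Objects of the orbit category: the finite subgroups `H` of `G`, standing for the
`G`-sets `G/H`. -/
structure OrbitCat (G : Type u) [Group G] : Type u where
  /-- the finite subgroup -/
  subgroup : Subgroup G
  finite : Finite subgroup

namespace OrbitCat

variable {G : Type u} [Group G]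

/-- Morphisms are the `G`-maps `G/H → G/K`. -/
instance : SmallCategory (OrbitCat G) where
  Hom H K := (G ⧸ H.subgroup) →[G] (G ⧸ K.subgroup)
  id H := MulActionHom.id G
  comp f g := g.comp f

/-- Right modules over the orbit category: contravariant functors to `ℤ`-modules, that is, to
abelian groups. -/
abbrev Mod (G : Type u) [Group G] : Type (u + 1) := (OrbitCat G)ᵒᵖ ⥤ AddCommGrpCat.{u}

/-- The constant module with value `ℤ`. -/
def trivialMod (G : Type u) [Group G] : Mod G :=
  (Functor.const _).obj (AddCommGrpCat.of (ULift.{u} ℤ))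

/-- The free module `P_K = ℤ[-, G/K]`: its value at `G/L` is the free abelian group on the set of
`G`-maps `G/L → G/K`. -/
noncomputable def free (K : OrbitCat G) : Mod G := yoneda.obj K ⋙ AddCommGrpCat.free

/-- The value at `G/L` of the submodule of `M` generated by the values of `M` at the objects in
`S`. -/
def generatedAt (M : Mod G) (S : Set (OrbitCat G)) (L : (OrbitCat G)ᵒᵖ) : AddSubgroup (M.obj L) :=
  AddSubgroup.closure {y | ∃ H ∈ S, ∃ (φ : L.unop ⟶ H) (x : M.obj (Opposite.op H)),
    y = (M.map φ.op).hom x}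

theorem generatedAt_map (M : Mod G) (S : Set (OrbitCat G)) {L L' : (OrbitCat G)ᵒᵖ} (f : L ⟶ L') :
    generatedAt M S L ≤ (generatedAt M S L').comap (M.map f).hom := by
  refine (AddSubgroup.closure_le _).2 ?_
  rintro _ ⟨H, hH, φ, x, rfl⟩
  refine AddSubgroup.subset_closure ⟨H, hH, f.unop ≫ φ, x, ?_⟩
  rw [op_comp, M.map_comp]
  rfl

/-- The submodule of `M` generated by the values of `M` at the objects in `S`. -/
def generated (M : Mod G) (S : Set (OrbitCat G)) : Mod G where
  obj L := AddCommGrpCat.of (generatedAt M S L)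
  map {L L'} f := AddCommGrpCat.ofHom
    (((M.map f).hom.comp (generatedAt M S L).subtype).codRestrict (generatedAt M S L')
      fun y => generatedAt_map M S f y.2)
  map_id L := by
    refine AddCommGrpCat.ext fun y => Subtype.ext ?_
    exact (congrArg (fun t => t.hom y.1) (M.map_id L))
  map_comp f g := by
    refine AddCommGrpCat.ext fun y => Subtype.ext ?_
    exact (congrArg (fun t => t.hom y.1) (M.map_comp f g))

/-- The inclusion of the generated submodule. -/
def generatedι (M : Mod G) (S : Set (OrbitCat G)) : generated M S ⟶ M where
  app L := AddCommGrpCat.ofHom (generatedAt M S L).subtype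

/-- The finite subgroups of `G` that are conjugate to a proper subgroup of `K`. -/
def properSubconjugates (K : OrbitCat G) : Set (OrbitCat G) :=
  {H | ∃ g : G, H.subgroup.map (MulAut.conj g).toMonoidHom < K.subgroup}

/-- The submodule `N_K` of `P_K` generated by the finite subgroups conjugate to a proper subgroup
of `K`. -/
noncomputable def N (K : OrbitCat G) : Mod G := generated (free K) (properSubconjugates K)

/-- The inclusion `N_K → P_K`. -/
noncomputable def Nι (K : OrbitCat G) : N K ⟶ free K :=
  generatedι (free K) (properSubconjugates K)

/-- The module `Q_K`, the cokernel of the inclusion `N_K → P_K`. -/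
noncomputable def Q (K : OrbitCat G) : Mod G := Limits.cokernel (Nι K)

/-! ### Bredon cohomology -/

/-- Maps `P_K → M` correspond to elements of `M(G/K)` (Yoneda). -/
noncomputable def freeEquiv (K : OrbitCat G) (M : Mod G) :
    (free K ⟶ M) ≃ M.obj (Opposite.op K) :=
  ((AddCommGrpCat.adj.whiskerRight (OrbitCat G)ᵒᵖ).homEquiv (yoneda.obj K) M).trans yonedaEquiv

theorem freeEquiv_comp {K : OrbitCat G} {M M' : Mod G} (f : free K ⟶ M) (e : M ⟶ M') :
    freeEquiv K M' (f ≫ e) = (e.app (Opposite.op K)).hom (freeEquiv K M f) := by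
  exact (congrArg yonedaEquiv (Adjunction.homEquiv_naturality_right
    (AddCommGrpCat.adj.whiskerRight (OrbitCat G)ᵒᵖ) f e)).trans (yonedaEquiv_comp _ _)

instance free_projective (K : OrbitCat G) : Projective (free K) where
  factors {M E} f e he := by
    have hs : Function.Surjective (e.app (Opposite.op K)).hom :=
      (AddCommGrpCat.epi_iff_surjective _).1 inferInstance
    obtain ⟨x, hx⟩ := hs (freeEquiv K _ f)
    refine ⟨(freeEquiv K _).symm x, (freeEquiv K _).injective ?_⟩
    rw [freeEquiv_comp, Equiv.apply_symm_apply, hx]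

/-- Every module is a quotient of a direct sum of free modules. -/
instance : EnoughProjectives (Mod G) where
  presentation M := ⟨{
    p := ∐ fun i : Σ K : OrbitCat G, M.obj (Opposite.op K) => free i.1
    f := Limits.Sigma.desc fun i => (freeEquiv i.1 M).symm i.2
    epi := by
      rw [NatTrans.epi_iff_epi_app]
      intro L
      rw [AddCommGrpCat.epi_iff_surjective]
      intro m
      refine ⟨freeEquiv L.unop _ (Limits.Sigma.ι
        (fun i : Σ K : OrbitCat G, M.obj (Opposite.op K) => free i.1) ⟨L.unop, m⟩), ?_⟩
      refine (freeEquiv_comp _ _).symm.trans ?_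
      rw [Limits.Sigma.ι_desc, Equiv.apply_symm_apply] }⟩

/-- The Bredon cohomology `H^n_F(G, M)`: the `n`-th cohomology of the cochain complex
`Hom(P_*, M)`, where `P_*` is a projective resolution of the constant module `ℤ`. -/
noncomputable def bredonCohomology (n : ℕ) (M : Mod G) : ModuleCat ℤ :=
  ((projectiveResolution (trivialMod G)).complex.linearYonedaObj ℤ M).homology n

/-- The Bredon cohomological dimension of `G` for proper actions: the smallest length of a
projective resolution of the constant module `ℤ` (infinite if there is no resolution of finite
length). -/
noncomputable def bredonDim (G : Type u) [Group G] : WithBot ℕ∞ :=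
  sInf {d | ∃ n : ℕ, d = ((n : ℕ∞) : WithBot ℕ∞) ∧
    ∃ P : ProjectiveResolution (trivialMod G), ∀ i, n < i → Limits.IsZero (P.complex.X i)}

end OrbitCat

/-! The heart of the proof is to exhibit a projective resolution `P` of the constant module as a
homotopy retract of a bounded complex `D` whose terms are retracts of finite sums of free modules
`P_K`.

In degree `n`, `D` is free on the `G`-set of strictly decreasing sequences of `n + 1` non-empty sets
of closed cells of `X`, each contained in the set `σ y` of cells through some point. Cocompactness
and finite stabilizers make each cell meet only finitely many others, so these `G`-sets have
finitely many orbits and finite stabilizers, and they are empty in high degrees. Contractibility of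
the fixed point sets makes equivariant singular chains of `X` acyclic (`singBd_exact`). Fine
subdivision followed by a coning construction maps singular chains to `D` over the augmentation
(`toChain_singBd`). Hence there are maps from `P` to singular chains, from there to `D`, and from
`D` back to `P`; their composite covers the identity and is homotopic to it
(`exists_factorization`). Neither exactness of `D` nor projectivity of singular chains is needed.

Consequently cohomology vanishes in high degrees. Let `d` be the largest degree in which it is
non-zero for some coefficients. In degree `d` it is right exact. If it vanished there on every
`Q_K`, induction on the order of `K` would give vanishing on every `P_K`: `N_K` is a quotient of a
finite sum of `P_H` with `H < K`, and `N_K → P_K → Q_K` is short exact (`cohomologyVanishes_free`).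
It would then vanish on `D_d`. A degree `d` cocycle `w` with values in any `M` is cohomologous to
its composite with `P → D → P`, so it factors up to coboundary through a quotient of `D_d`, and
vanishing would follow for all `M` (`CohomologyVanishes.of_terms`), a contradiction. Finally,
vanishing above `d` yields a resolution of length `d` (`isZero_min`), and non-vanishing in degree
`d` forbids a shorter one.

Indexing convention: a tuple over `Fin n` is a simplex of dimension `n - 1`, and the empty tuple
carries the augmentation. -/

/-! ### Alternating boundary operators on free abelian groups -/

namespace FreeChain

open FreeAbelianGroup

/-- Pairwise cancellation in an alternating double sum. -/
theorem alternating_sum_eq_zero {A : Type*} [AddCommGroup A] {m : ℕ}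
    (f : Fin (m + 1) → Fin m → A)
    (h : ∀ i j : Fin m, i ≤ j → f j.succ i = f i.castSucc j) :
    ∑ i : Fin (m + 1), ∑ j : Fin m, (-1 : ℤ) ^ (i : ℕ) • (-1 : ℤ) ^ (j : ℕ) • f i j = 0 := by
  rw [← Finset.sum_product', Finset.univ_product_univ]
  -- The pairs `(i, j)` with `j < i` are matched with the pairs `(j, i - 1)`; matched terms agree up
  -- to opposite signs.
  let S : Finset (Fin (m + 1) × Fin m) := {p | (p.2 : ℕ) < (p.1 : ℕ)}
  rw [← Finset.sum_add_sum_compl S, ← eq_neg_iff_add_eq_zero, ← Finset.sum_neg_distrib]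
  refine Finset.sum_bij' (fun p hp => (p.2.castSucc, p.1.pred ?_))
    (fun p hp => (p.2.succ, p.1.castLT ?_)) ?_ ?_ ?_ ?_ ?_
  · rintro h0
    simp [S, h0] at hp
  · simp only [S, Finset.compl_filter, Finset.mem_filter_univ, not_lt] at hp
    exact lt_of_le_of_lt hp p.2.2
  · rintro ⟨i, j⟩ hp
    simp only [S, Finset.compl_filter, Finset.mem_filter_univ, not_lt, Fin.val_castSucc,
      Fin.val_pred] at hp ⊢
    omega
  · rintro ⟨i, j⟩ hp
    simp only [S, Finset.compl_filter, Finset.mem_filter_univ, not_lt, Fin.val_castLT,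
      Fin.val_succ] at hp ⊢
    omega
  · rintro ⟨i, j⟩ hp
    simp
  · rintro ⟨i, j⟩ hp
    simp
  · rintro ⟨i, j⟩ hp
    simp only [S, Finset.mem_filter_univ] at hp
    have hi : i ≠ 0 := by rintro rfl; simp at hp
    obtain ⟨k, rfl⟩ := Fin.exists_succ_eq.2 hi
    have hk := h j k (by simp at hp; exact Fin.le_def.2 (by omega))
    simp only [Fin.val_succ, Fin.val_castSucc, Fin.pred_succ, hk, smul_smul, ← neg_smul]
    congr 1
    ring

theorem map_comp_eq {α β γ : Type*} (f : α → β) (g : β → γ) (x : FreeAbelianGroup α) :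
    map g (map f x) = map (fun a => g (f a)) x := (map_comp_apply (f := f) (g := g) x).symm

/-- The alternating sum of face operators. -/
def bd {S T : Type*} {n : ℕ} (d : Fin n → S → T) : FreeAbelianGroup S →+ FreeAbelianGroup T :=
  lift fun s => ∑ i : Fin n, (-1 : ℤ) ^ (i : ℕ) • of (d i s)

theorem bd_of {S T : Type*} {n : ℕ} (d : Fin n → S → T) (s : S) :
    bd d (of s) = ∑ i : Fin n, (-1 : ℤ) ^ (i : ℕ) • of (d i s) := by
  simp [bd]

theorem bd_bd {R S T : Type*} {m : ℕ} (d' : Fin (m + 1) → R → S) (d : Fin m → S → T)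
    (h : ∀ (i j : Fin m) (r : R), i ≤ j → d i (d' j.succ r) = d j (d' i.castSucc r))
    (x : FreeAbelianGroup R) : bd d (bd d' x) = 0 := by
  have : (bd d).comp (bd d') = 0 := by
    refine lift_ext _ _ fun r => ?_
    simp only [AddMonoidHom.comp_apply, bd_of, map_sum, map_zsmul, AddMonoidHom.zero_apply,
      Finset.smul_sum]
    exact alternating_sum_eq_zero (fun i j => of (d j (d' i r)))
      fun i j hij => congrArg of (h i j r hij)
  exact DFunLike.congr_fun this x

theorem bd_map {S T S' T' : Type*} {n : ℕ} (d : Fin n → S → T) (d' : Fin n → S' → T')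
    (f : S → S') (g : T → T') (h : ∀ i s, d' i (f s) = g (d i s)) (x : FreeAbelianGroup S) :
    bd d' (map f x) = map g (bd d x) := by
  have : (bd d').comp (map f) = (map g).comp (bd d) := by
    refine lift_ext _ _ fun s => ?_
    simp [bd_of, h]
  exact DFunLike.congr_fun this x

/-- The subgroup generated by the basis elements in `S`. -/
def supp {T : Type*} (S : Set T) : AddSubgroup (FreeAbelianGroup T) := AddSubgroup.closure (of '' S)

theorem of_mem_supp {T : Type*} {S : Set T} {t : T} (h : t ∈ S) : of t ∈ supp S :=
  AddSubgroup.subset_closure ⟨t, h, rfl⟩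

theorem supp_mono {T : Type*} {S S' : Set T} (h : S ⊆ S') : supp S ≤ supp S' :=
  AddSubgroup.closure_mono (Set.image_mono h)

theorem mem_of_supp {T A : Type*} [AddCommGroup A] {S : Set T} (f : FreeAbelianGroup T →+ A)
    (B : AddSubgroup A) (h : ∀ t ∈ S, f (of t) ∈ B) {x : FreeAbelianGroup T} (hx : x ∈ supp S) :
    f x ∈ B := by
  have : supp S ≤ B.comap f := by
    refine (AddSubgroup.closure_le _).2 ?_
    rintro _ ⟨t, ht, rfl⟩
    exact h t ht
  exact this hx

theorem eq_of_supp {T A : Type*} [AddCommGroup A] {S : Set T} (f g : FreeAbelianGroup T →+ A)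
    (h : ∀ t ∈ S, f (of t) = g (of t)) {x : FreeAbelianGroup T} (hx : x ∈ supp S) :
    f x = g x := by
  refine AddMonoidHom.eqOn_closure (f := f) (g := g) ?_ hx
  rintro _ ⟨t, ht, rfl⟩
  exact h t ht

theorem mem_supp_univ {T : Type*} (x : FreeAbelianGroup T) : x ∈ supp (Set.univ : Set T) := by
  induction x using FreeAbelianGroup.induction_on with
  | zero => exact zero_mem _
  | of t => exact of_mem_supp trivial
  | neg t h => exact neg_mem h
  | add a b ha hb => exact add_mem ha hb

/-! ### Chains of tuples -/

variable {Y : Type*}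

/-- Omit an entry of a tuple. -/
def face {n : ℕ} (i : Fin (n + 1)) (τ : Fin (n + 1) → Y) : Fin n → Y := fun k => τ (i.succAbove k)

theorem succAbove_comm {m : ℕ} (i j : Fin (m + 1)) (h : i ≤ j) (k : Fin m) :
    j.succ.succAbove (i.succAbove k) = i.castSucc.succAbove (j.succAbove k) := by
  have := (Fin.succAbove_succAbove_succAbove_predAbove (i.castSucc) j k).symm
  rw [Fin.succAbove_castSucc_of_le _ _ h] at this
  rw [this, Fin.predAbove_castSucc_of_le _ _ h]

theorem face_face {m : ℕ} (i j : Fin (m + 1)) (τ : Fin (m + 2) → Y) (h : i ≤ j) :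
    face i (face j.succ τ) = face j (face i.castSucc τ) :=
  funext fun k => congrArg τ (succAbove_comm i j h k)

/-- The boundary of a chain of tuples. -/
def tbd (n : ℕ) : FreeAbelianGroup (Fin (n + 1) → Y) →+ FreeAbelianGroup (Fin n → Y) := bd face

theorem tbd_of {n : ℕ} (τ : Fin (n + 1) → Y) :
    tbd n (of τ) = ∑ i : Fin (n + 1), (-1 : ℤ) ^ (i : ℕ) • of (face i τ) := bd_of _ _

theorem tbd_tbd {n : ℕ} (x : FreeAbelianGroup (Fin (n + 2) → Y)) : tbd n (tbd (n + 1) x) = 0 :=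
  bd_bd _ _ (fun i j τ h => face_face i j τ h) x

/-- The cone of a chain of tuples. -/
def tcone (n : ℕ) (p : Y) : FreeAbelianGroup (Fin n → Y) →+ FreeAbelianGroup (Fin (n + 1) → Y) :=
  map fun τ => (Fin.cons p τ : Fin (n + 1) → Y)

theorem tcone_of {n : ℕ} (p : Y) (τ : Fin n → Y) :
    tcone n p (of τ) = of (Fin.cons p τ : Fin (n + 1) → Y) := map_of_apply _

/-- There is only the empty tuple, and `tbd 0` is the augmentation of chains of vertices. -/
theorem tbd_tcone_zero (p : Y) (x : FreeAbelianGroup (Fin 0 → Y)) : tbd 0 (tcone 0 p x) = x := by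
  have : (tbd 0).comp (tcone 0 p) = AddMonoidHom.id _ := by
    refine lift_ext _ _ fun τ => ?_
    simp only [AddMonoidHom.comp_apply, tcone_of, tbd_of, AddMonoidHom.id_apply]
    simp [Subsingleton.elim (face _ _) τ]
  exact DFunLike.congr_fun this x

/-- Face zero of a cone is the base; the other faces are cones over the faces of the base, with the
sign shifted by one. -/
theorem tbd_tcone {n : ℕ} (p : Y) (x : FreeAbelianGroup (Fin (n + 1) → Y)) :
    tbd (n + 1) (tcone (n + 1) p x) = x - tcone n p (tbd n x) := by
  have : (tbd (n + 1)).comp (tcone (n + 1) p) =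
      AddMonoidHom.id _ - (tcone n p).comp (tbd n) := by
    refine lift_ext _ _ fun τ => ?_
    simp only [AddMonoidHom.comp_apply, tcone_of, tbd_of, AddMonoidHom.id_apply,
      AddMonoidHom.sub_apply, map_sum, map_zsmul]
    rw [Fin.sum_univ_succ, sub_eq_add_neg, ← Finset.sum_neg_distrib]
    refine congrArg₂ (· + ·) (by simp; rfl) (Finset.sum_congr rfl fun i _ => ?_)
    rw [Fin.val_succ, pow_succ, mul_neg_one, neg_smul]
    congr 3
    funext k
    refine Fin.cases ?_ (fun k => ?_) k <;> simp [face]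
  exact DFunLike.congr_fun this x

theorem tbd_map {Z : Type*} {n : ℕ} (f : Y → Z) (x : FreeAbelianGroup (Fin (n + 1) → Y)) :
    tbd n (map (fun τ i => f (τ i)) x) = map (fun τ i => f (τ i)) (tbd n x) :=
  bd_map face face (fun τ i => f (τ i)) (fun τ i => f (τ i)) (fun _ _ => rfl) x

theorem tcone_map {Z : Type*} {n : ℕ} (f : Y → Z) (p : Y) (x : FreeAbelianGroup (Fin n → Y)) :
    tcone n (f p) (map (fun τ i => f (τ i)) x) = map (fun τ i => f (τ i)) (tcone n p x) := by
  simp only [tcone, map_comp_eq]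
  congr 2
  funext τ
  funext i
  refine Fin.cases ?_ (fun k => ?_) i <;> simp

end FreeChain

/-! ### Subdivision of linear chains -/

namespace FreeChain

open FreeAbelianGroup

theorem tbd_mem_supp {Y : Type*} {n : ℕ} {S : Set (Fin (n + 1) → Y)} {S' : Set (Fin n → Y)}
    (h : ∀ τ ∈ S, ∀ i, face i τ ∈ S') {x : FreeAbelianGroup (Fin (n + 1) → Y)} (hx : x ∈ supp S) :
    tbd n x ∈ supp S' := by
  refine mem_of_supp _ _ (fun τ hτ => ?_) hx
  rw [tbd_of]
  exact sum_mem fun i _ => zsmul_mem (of_mem_supp (h τ hτ i)) _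

theorem tcone_mem_supp {Y : Type*} {n : ℕ} {p : Y} {S : Set (Fin n → Y)}
    {S' : Set (Fin (n + 1) → Y)} (h : ∀ τ ∈ S, (Fin.cons p τ : Fin (n + 1) → Y) ∈ S')
    {x : FreeAbelianGroup (Fin n → Y)} (hx : x ∈ supp S) : tcone n p x ∈ supp S' := by
  refine mem_of_supp _ _ (fun τ hτ => ?_) hx
  rw [tcone_of]
  exact of_mem_supp (h τ hτ)

/-! ### Barycentric subdivision and fillings of small cycles. -/

variable {E : Type*} [NormedAddCommGroup E] [NormedSpace ℝ E]

/-- The barycenter of a non-empty tuple of points. -/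
noncomputable def bary {n : ℕ} (τ : Fin (n + 1) → E) : E := ((n : ℝ) + 1)⁻¹ • ∑ i, τ i

theorem bary_mem {n : ℕ} {τ : Fin (n + 1) → E} {C : Set E} (hC : Convex ℝ C) (h : ∀ i, τ i ∈ C) :
    bary τ ∈ C := by
  have hn : (0 : ℝ) < (n : ℝ) + 1 := by positivity
  rw [bary, Finset.smul_sum]
  refine hC.sum_mem (fun _ _ => by positivity) ?_ fun i _ => h i
  simp [mul_inv_cancel₀ hn.ne']

/-- The difference is the average of the `τ i - τ j`; the term `i = j` is zero, which leaves `n` of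
the `n + 1` terms. -/
theorem dist_bary_le {n : ℕ} {τ : Fin (n + 1) → E} {r : ℝ} (h : ∀ i j, dist (τ i) (τ j) ≤ r)
    (j : Fin (n + 1)) : dist (bary τ) (τ j) ≤ n / (n + 1) * r := by
  have hn : (0 : ℝ) < (n : ℝ) + 1 := by positivity
  have h1 : bary τ - τ j = ((n : ℝ) + 1)⁻¹ • ∑ i, (τ i - τ j) := by
    rw [Finset.sum_sub_distrib, smul_sub, bary]
    simp only [Finset.sum_const, Finset.card_univ, Fintype.card_fin]
    rw [← Nat.cast_smul_eq_nsmul ℝ, smul_smul]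
    push_cast
    rw [inv_mul_cancel₀ hn.ne', one_smul]
  rw [dist_eq_norm, h1, norm_smul, Real.norm_of_nonneg (by positivity), div_eq_inv_mul, mul_assoc]
  refine mul_le_mul_of_nonneg_left ?_ (by positivity)
  rw [Fin.sum_univ_succAbove _ j, sub_self, zero_add]
  refine (norm_sum_le _ _).trans ?_
  refine (Finset.sum_le_sum fun i _ => (dist_eq_norm _ _).symm.trans_le (h _ _)).trans ?_
  simp

/-- Barycentric subdivision of linear chains. -/
noncomputable def sd : ∀ n, FreeAbelianGroup (Fin n → E) →+ FreeAbelianGroup (Fin n → E)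
  | 0 => AddMonoidHom.id _
  | n + 1 => lift fun τ => tcone n (bary τ) (sd n (tbd n (of τ)))

theorem sd_of {n : ℕ} (τ : Fin (n + 1) → E) :
    sd (n + 1) (of τ) = tcone n (bary τ) (sd n (tbd n (of τ))) := by
  simp [sd]

theorem tbd_sd : ∀ (n : ℕ) (x : FreeAbelianGroup (Fin (n + 1) → E)),
    tbd n (sd (n + 1) x) = sd n (tbd n x)
  | 0, x => by
    have : (tbd 0).comp (sd (E := E) 1) = (sd 0).comp (tbd 0) :=
      lift_ext _ _ fun τ => by
        rw [AddMonoidHom.comp_apply, sd_of, tbd_tcone_zero, AddMonoidHom.comp_apply]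
    exact DFunLike.congr_fun this x
  | n + 1, x => by
    have : (tbd (n + 1)).comp (sd (E := E) (n + 2)) = (sd (n + 1)).comp (tbd (n + 1)) :=
      lift_ext _ _ fun τ => by
        rw [AddMonoidHom.comp_apply, sd_of, tbd_tcone, AddMonoidHom.comp_apply, tbd_sd n, tbd_tbd,
          map_zero, map_zero, sub_zero]
    exact DFunLike.congr_fun this x

/-- The homotopy between the identity and the barycentric subdivision. -/
noncomputable def sdH : ∀ n, FreeAbelianGroup (Fin n → E) →+ FreeAbelianGroup (Fin (n + 1) → E)
  | 0 => 0
  | n + 1 => lift fun τ =>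
      tcone (n + 1) (bary τ) (of τ - sd (n + 1) (of τ) - sdH n (tbd n (of τ)))

theorem sdH_of {n : ℕ} (τ : Fin (n + 1) → E) : sdH (n + 1) (of τ) =
    tcone (n + 1) (bary τ) (of τ - sd (n + 1) (of τ) - sdH n (tbd n (of τ))) := by
  simp [sdH]

/-- The chain coned off in `sdH` is a cycle by the same identity one degree lower, so the boundary
of its cone is the chain itself. -/
theorem tbd_sdH : ∀ (n : ℕ) (x : FreeAbelianGroup (Fin (n + 1) → E)),
    tbd (n + 1) (sdH (n + 1) x) = x - sd (n + 1) x - sdH n (tbd n x) := by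
  have key : ∀ (n : ℕ) (h : ∀ τ : Fin (n + 1) → E,
      tbd n (sdH n (tbd n (of τ))) = tbd n (of τ) - sd n (tbd n (of τ)))
      (x : FreeAbelianGroup (Fin (n + 1) → E)),
      tbd (n + 1) (sdH (n + 1) x) = x - sd (n + 1) x - sdH n (tbd n x) := by
    intro n h x
    have : (tbd (n + 1)).comp (sdH (n + 1)) =
        AddMonoidHom.id _ - sd (n + 1) - (sdH n).comp (tbd (Y := E) n) :=
      lift_ext _ _ fun τ => by
        rw [AddMonoidHom.comp_apply, sdH_of, tbd_tcone]
        simp only [map_sub, h, tbd_sd, sub_self, map_zero, sub_zero, AddMonoidHom.sub_apply,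
          AddMonoidHom.id_apply, AddMonoidHom.comp_apply]
    exact DFunLike.congr_fun this x
  intro n
  induction n with
  | zero => exact key 0 fun τ => by simp [sdH, sd]
  | succ n ih =>
    refine key (n + 1) fun τ => ?_
    rw [ih, tbd_tbd, map_zero, sub_zero]

/-- Tuples in a given set. -/
def tuplesIn {Y : Type*} (C : Set Y) (n : ℕ) : Set (Fin n → Y) := {τ | ∀ i, τ i ∈ C}

theorem cons_mem_tuplesIn {Y : Type*} {C : Set Y} {n : ℕ} {p : Y} (hp : p ∈ C) {τ : Fin n → Y}
    (hτ : τ ∈ tuplesIn C n) : (Fin.cons p τ : Fin (n + 1) → Y) ∈ tuplesIn C (n + 1) :=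
  fun i => Fin.cases hp hτ i

theorem tbd_mem_tuplesIn {Y : Type*} {C : Set Y} {n : ℕ} {x : FreeAbelianGroup (Fin (n + 1) → Y)}
    (hx : x ∈ supp (tuplesIn C (n + 1))) : tbd n x ∈ supp (tuplesIn C n) :=
  tbd_mem_supp (S := tuplesIn C (n + 1)) (S' := tuplesIn C n) (fun _ hτ _ _ => hτ _) hx

theorem sd_mem {C : Set E} (hC : Convex ℝ C) : ∀ {n : ℕ} {x : FreeAbelianGroup (Fin n → E)},
    x ∈ supp (tuplesIn C n) → sd n x ∈ supp (tuplesIn C n)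
  | 0, _, hx => hx
  | n + 1, _, hx => by
    refine mem_of_supp _ _ (fun τ hτ => ?_) hx
    rw [sd_of]
    exact tcone_mem_supp (fun _ h => cons_mem_tuplesIn (bary_mem hC hτ) h)
      (sd_mem hC (tbd_mem_tuplesIn (of_mem_supp hτ)))

theorem sdH_mem {C : Set E} (hC : Convex ℝ C) : ∀ {n : ℕ} {x : FreeAbelianGroup (Fin n → E)},
    x ∈ supp (tuplesIn C n) → sdH n x ∈ supp (tuplesIn C (n + 1))
  | 0, _, _ => zero_mem _
  | n + 1, _, hx => by
    refine mem_of_supp _ _ (fun τ hτ => ?_) hx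
    rw [sdH_of]
    have h := of_mem_supp hτ
    exact tcone_mem_supp (fun _ h => cons_mem_tuplesIn (bary_mem hC hτ) h)
      (sub_mem (sub_mem h (sd_mem hC h)) (sdH_mem hC (tbd_mem_tuplesIn h)))

/-- Tuples in `K` with pairwise distances at most `r`. -/
def mesh (K : Set E) (r : ℝ) (n : ℕ) : Set (Fin n → E) :=
  {τ | τ ∈ tuplesIn K n ∧ ∀ i j, dist (τ i) (τ j) ≤ r}

/-- New edges either join a barycenter to a point of the same simplex, or come from subdividing a
face. `N` bounds the dimension so that one factor `q` serves all faces; `C` is kept general because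
the recursion passes to the hull of the simplex. -/
theorem sd_mem_mesh {K : Set E} {q r : ℝ} (hq : 0 ≤ q) (hr : 0 ≤ r) {N : ℕ}
    (hN : (N : ℝ) / (N + 1) ≤ q) :
    ∀ {n : ℕ}, n ≤ N + 1 → ∀ {C : Set E}, Convex ℝ C → C ⊆ K →
      ∀ {x : FreeAbelianGroup (Fin n → E)},
      x ∈ supp (mesh C r n) → sd n x ∈ supp (mesh C (q * r) n)
  | 0, _, C, _, _, x, hx => by
    refine supp_mono ?_ hx
    rintro τ ⟨h, -⟩
    exact ⟨h, fun i => i.elim0⟩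
  | n + 1, hn, C, hC, hCK, x, hx => by
    refine mem_of_supp _ _ (fun τ hτ => ?_) hx
    rw [sd_of]
    -- Staying in the hull of `τ` keeps all vertices of the subdivided boundary within `q * r` of
    -- the barycenter.
    set D := convexHull ℝ (Set.range τ)
    have hDC : D ⊆ C := convexHull_min (Set.range_subset_iff.2 hτ.1) hC
    have hτD : ∀ i, τ i ∈ D := fun i => subset_convexHull ℝ _ ⟨i, rfl⟩
    have hb : bary τ ∈ D := bary_mem (convex_convexHull ℝ _) hτD
    have hd : ∀ y ∈ D, dist y (bary τ) ≤ q * r := by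
      intro y hy
      have hball : D ⊆ Metric.closedBall (bary τ) (q * r) := by
        refine convexHull_min ?_ (convex_closedBall _ _)
        rintro _ ⟨i, rfl⟩
        rw [Metric.mem_closedBall, dist_comm]
        refine (dist_bary_le hτ.2 i).trans (mul_le_mul_of_nonneg_right (le_trans ?_ hN) hr)
        have h1 : (n : ℝ) ≤ N := by exact_mod_cast Nat.le_of_succ_le_succ hn
        rw [div_le_div_iff₀ (by positivity) (by positivity)]
        nlinarith
      exact hball hy
    refine supp_mono (S := mesh D (q * r) (n + 1)) (S' := mesh C (q * r) (n + 1))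
      (fun σ hσ => ⟨fun i => hDC (hσ.1 i), hσ.2⟩) ?_
    refine tcone_mem_supp (S := mesh D (q * r) n) (fun σ hσ => ?_) ?_
    · refine ⟨cons_mem_tuplesIn hb hσ.1, fun i j => ?_⟩
      refine Fin.cases ?_ (fun i => ?_) i <;> refine Fin.cases ?_ (fun j => ?_) j
      · simpa using mul_nonneg hq hr
      · simpa [dist_comm] using hd _ (hσ.1 j)
      · simpa using hd _ (hσ.1 i)
      · simpa using hσ.2 i j
    · refine sd_mem_mesh hq hr hN (by omega) (convex_convexHull ℝ _) (hDC.trans hCK) ?_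
      refine tbd_mem_supp (S := mesh D r (n + 1)) (fun σ hσ i => ?_)
        (of_mem_supp (show τ ∈ mesh D r (n + 1) from ⟨hτD, hτ.2⟩))
      exact ⟨fun k => hσ.1 _, fun k l => hσ.2 _ _⟩

/-- Tuples contained in a convex subset of a member of `W`. -/
def small (W : Set (Set E)) (n : ℕ) : Set (Fin n → E) :=
  {τ | ∃ C : Set E, Convex ℝ C ∧ (∃ V ∈ W, C ⊆ V) ∧ τ ∈ tuplesIn C n}

theorem supp_tuplesIn_le_small {W : Set (Set E)} {C V : Set E} (hC : Convex ℝ C) (hV : V ∈ W)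
    (hCV : C ⊆ V) (n : ℕ) : supp (tuplesIn C n) ≤ supp (small W n) :=
  supp_mono fun _ hτ => ⟨C, hC, ⟨V, hV, hCV⟩, hτ⟩

/-- `W` has a Lebesgue number on `K`. -/
def HasLebesgue (K : Set E) (W : Set (Set E)) : Prop :=
  ∃ δ > 0, ∀ C ⊆ K, C.Nonempty → (∀ x ∈ C, ∀ y ∈ C, dist x y ≤ δ) → ∃ V ∈ W, C ⊆ V

/-- A cycle of small linear simplices in a bounded convex set bounds a chain of small linear
simplices. -/
theorem exists_small_filling {K : Set E} (hK : Convex ℝ K) (hb : Bornology.IsBounded K)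
    (hne : K.Nonempty) {W : Set (Set E)} (hWK : ∀ V ∈ W, V ⊆ K) (hW : HasLebesgue K W) {n : ℕ}
    {w : FreeAbelianGroup (Fin (n + 1) → E)} (hw : w ∈ supp (small W (n + 1)))
    (hw0 : tbd n w = 0) :
    ∃ c ∈ supp (small W (n + 2)), tbd (n + 1) c = w := by
  obtain ⟨δ, hδ, hL⟩ := hW
  obtain ⟨p, hp⟩ := hne
  obtain ⟨R, hR⟩ := Metric.isBounded_iff.1 hb
  have hR0 : 0 ≤ R := dist_nonneg.trans (hR hp hp)
  -- The factor by which subdivision shrinks a filling, whose simplices have dimension `n + 1`.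
  set q : ℝ := ((n + 1 : ℕ) : ℝ) / ((n + 1 : ℕ) + 1)
  have hq0 : 0 ≤ q := by positivity
  have hq1 : q < 1 := by
    rw [div_lt_one (by positivity)]
    linarith
  have small_of_mesh : supp (mesh K δ (n + 2)) ≤ supp (small W (n + 2)) := by
    -- A convex hull has the same diameter as its vertex set, so the Lebesgue number applies to the
    -- whole simplex.
    refine supp_mono fun τ hτ => ?_
    obtain ⟨V, hV, hCV⟩ := hL (convexHull ℝ (Set.range τ))
      (convexHull_min (Set.range_subset_iff.2 hτ.1) hK)
      ⟨τ 0, subset_convexHull ℝ _ ⟨0, rfl⟩⟩ (fun x hx y hy => by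
        obtain ⟨x', ⟨i, rfl⟩, y', ⟨j, rfl⟩, h⟩ := convexHull_exists_dist_ge2 hx hy
        exact h.trans (hτ.2 i j))
    exact ⟨_, convex_convexHull ℝ _, ⟨V, hV, hCV⟩, fun i => subset_convexHull ℝ _ ⟨i, rfl⟩⟩
  -- Induction on the number `k` of subdivisions that bring the mesh `r` of a given filling below
  -- `δ`.
  have key : ∀ (k : ℕ) (r : ℝ) (w : FreeAbelianGroup (Fin (n + 1) → E)), 0 ≤ r → q ^ k * r ≤ δ →
      w ∈ supp (small W (n + 1)) → tbd n w = 0 →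
      (∃ c ∈ supp (mesh K r (n + 2)), tbd (n + 1) c = w) →
      ∃ c ∈ supp (small W (n + 2)), tbd (n + 1) c = w := by
    intro k
    induction k with
    | zero =>
      rintro r w - hr - - ⟨c, hc, rfl⟩
      refine ⟨c, small_of_mesh (supp_mono (S := mesh K r (n + 2)) (S' := mesh K δ (n + 2))
        (fun τ hτ => ⟨hτ.1, fun i j =>
        (hτ.2 i j).trans (by simpa using hr)⟩) hc), rfl⟩
    | succ k ih =>
      rintro r w hr0 hr hw hw0 ⟨c, hc, rfl⟩
      obtain ⟨e, he, hew⟩ := ih (q * r) (sd (n + 1) (tbd (n + 1) c)) (by positivity)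
        (by rw [← mul_assoc, ← pow_succ]; exact hr)
        (mem_of_supp (S := small W (n + 1)) _ _ (fun τ ⟨C, hC, ⟨V, hV, hCV⟩, hτ⟩ =>
          supp_tuplesIn_le_small hC hV hCV _ (sd_mem hC (of_mem_supp hτ))) hw)
        (by rw [tbd_sd, tbd_tbd, map_zero])
        ⟨sd (n + 2) c, sd_mem_mesh hq0 hr0 le_rfl le_rfl hK subset_rfl hc, tbd_sd _ _⟩
      -- `e` fills the subdivided cycle, and `sdH` fills the difference between the cycle and its
      -- subdivision. The latter is small because the cycle is: the homotopy stays in the same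
      -- convex sets.
      refine ⟨e + sdH (n + 1) (tbd (n + 1) c), add_mem he ?_, ?_⟩
      · exact mem_of_supp (S := small W (n + 1)) _ _ (fun τ ⟨C, hC, ⟨V, hV, hCV⟩, hτ⟩ =>
          supp_tuplesIn_le_small hC hV hCV _ (sdH_mem hC (of_mem_supp hτ))) hw
      · rw [map_add, tbd_sdH, hew, hw0, map_zero]
        abel
  obtain ⟨k, hk⟩ : ∃ k, q ^ k * R ≤ δ := by
    have := (tendsto_pow_atTop_nhds_zero_of_lt_one hq0 hq1).mul_const R
    rw [zero_mul] at this
    exact (this.eventually (ge_mem_nhds hδ)).exists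
  -- The initial filling is the cone from `p`, whose mesh is bounded by the diameter of `K`.
  refine key k R w hR0 hk hw hw0 ⟨tcone (n + 1) p w, ?_, ?_⟩
  · refine tcone_mem_supp (fun τ hτ => ?_) hw
    obtain ⟨C, -, ⟨V, hV, hCV⟩, hτC⟩ := hτ
    have := cons_mem_tuplesIn hp (fun i => hWK V hV (hCV (hτC i)) : τ ∈ tuplesIn K (n + 1))
    exact ⟨this, fun i j => hR (this i) (this j)⟩
  · rw [tbd_tcone, hw0, map_zero, sub_zero]

end FreeChain

/-! ### Coherent small subdivisions of the standard simplices -/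

namespace FreeChain

open FreeAbelianGroup

/-- The inclusion of a coordinate hyperplane. -/
def faceMap {n : ℕ} (i : Fin (n + 1)) : (Fin n → ℝ) →ₗ[ℝ] (Fin (n + 1) → ℝ) where
  toFun x := i.insertNth (α := fun _ => ℝ) 0 x
  map_add' x y := by
    funext k
    refine Fin.succAboveCases i ?_ (fun k => ?_) k <;> simp
  map_smul' a x := by
    funext k
    refine Fin.succAboveCases i ?_ (fun k => ?_) k <;> simp

@[simp] theorem faceMap_self {n : ℕ} (i : Fin (n + 1)) (x : Fin n → ℝ) : faceMap i x i = 0 :=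
  Fin.insertNth_apply_same (α := fun _ => ℝ) i 0 x

@[simp] theorem faceMap_succAbove {n : ℕ} (i : Fin (n + 1)) (x : Fin n → ℝ) (k : Fin n) :
    faceMap i x (i.succAbove k) = x k :=
  Fin.insertNth_apply_succAbove (α := fun _ => ℝ) i 0 x k

theorem faceMap_single {n : ℕ} (i : Fin (n + 1)) (l : Fin n) (a : ℝ) :
    faceMap i (Pi.single l a) = Pi.single (i.succAbove l) a := by
  funext k
  refine Fin.succAboveCases i ?_ (fun k => ?_) k
  · rw [faceMap_self, Pi.single_eq_of_ne (Fin.succAbove_ne i l).symm]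
  · rw [faceMap_succAbove]
    by_cases h : k = l
    · subst h; simp
    · rw [Pi.single_eq_of_ne h, Pi.single_eq_of_ne (fun h' => h (Fin.succAbove_right_injective h'))]

theorem faceMap_comm {m : ℕ} (i j : Fin (m + 1)) (h : i ≤ j) (x : Fin m → ℝ) :
    faceMap j.succ (faceMap i x) = faceMap i.castSucc (faceMap j x) := by
  have : (faceMap j.succ).comp (faceMap i) = (faceMap i.castSucc).comp (faceMap j) := by
    refine LinearMap.pi_ext fun l a => ?_
    simp only [LinearMap.comp_apply, faceMap_single, succAbove_comm i j h]
  exact LinearMap.congr_fun this x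

theorem faceMap_mem_stdSimplex_iff {n : ℕ} (i : Fin (n + 1)) (x : Fin n → ℝ) :
    faceMap i x ∈ stdSimplex ℝ (Fin (n + 1)) ↔ x ∈ stdSimplex ℝ (Fin n) := by
  refine and_congr ⟨fun h k => ?_, fun h k => ?_⟩ ?_
  · simpa using h (i.succAbove k)
  · refine Fin.succAboveCases i ?_ (fun k => ?_) k
    · simp
    · simpa using h k
  · rw [Fin.sum_univ_succAbove _ i]
    simp

theorem dist_faceMap_le {n : ℕ} (i : Fin (n + 1)) (x y : Fin n → ℝ) :
    dist (faceMap i x) (faceMap i y) ≤ dist x y := by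
  refine (dist_pi_le_iff dist_nonneg).2 fun k => ?_
  refine Fin.succAboveCases i ?_ (fun k => ?_) k
  · simp
  · simpa using dist_le_pi_dist x y k

/-- Restriction of a family of sets to a face. -/
def pull {n : ℕ} (i : Fin (n + 1)) (W : Set (Set (Fin (n + 1) → ℝ))) : Set (Set (Fin n → ℝ)) :=
  (fun V => faceMap i ⁻¹' V) '' W

theorem pull_comm {m : ℕ} (i j : Fin (m + 1)) (h : i ≤ j) (W : Set (Set (Fin (m + 2) → ℝ))) :
    pull i (pull j.succ W) = pull j (pull i.castSucc W) := by
  simp only [pull, Set.image_image, ← Set.preimage_comp]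
  refine Set.image_congr' fun V => ?_
  refine congrArg (fun f => f ⁻¹' V) (funext fun x => faceMap_comm i j h x)

/-- Push forward of linear chains along the inclusion of a face. -/
def push {n m : ℕ} (i : Fin (n + 1)) :
    FreeAbelianGroup (Fin m → (Fin n → ℝ)) →+ FreeAbelianGroup (Fin m → (Fin (n + 1) → ℝ)) :=
  map fun τ k => faceMap i (τ k)

theorem push_comm {m k : ℕ} (i j : Fin (m + 1)) (h : i ≤ j)
    (x : FreeAbelianGroup (Fin k → (Fin m → ℝ))) :
    push j.succ (push i x) = push i.castSucc (push j x) := by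
  simp only [push, map_comp_eq, faceMap_comm i j h]

open Classical in
/-- A linear chain in the simplex that is fine with respect to the cover `W`, chosen coherently
for all faces. -/
noncomputable def ell : ∀ n, Set (Set (Fin n → ℝ)) → FreeAbelianGroup (Fin n → (Fin n → ℝ))
  | 0, _ => of fun i => i.elim0
  | n + 1, W =>
    if h : ∃ c ∈ supp (small W (n + 1)),
        tbd n c = ∑ i : Fin (n + 1), (-1 : ℤ) ^ (i : ℕ) • push i (ell n (pull i W)) then
      h.choose
    else 0

/-- Families of subsets of the standard simplex that admit a Lebesgue number. -/
def GoodCover (n : ℕ) (W : Set (Set (Fin n → ℝ))) : Prop :=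
  (∀ V ∈ W, V ⊆ stdSimplex ℝ (Fin n)) ∧ HasLebesgue (stdSimplex ℝ (Fin n)) W

/-- The face inclusion does not increase distances, so the same Lebesgue number works. -/
theorem GoodCover.pull {n : ℕ} {W : Set (Set (Fin (n + 1) → ℝ))} (h : GoodCover (n + 1) W)
    (i : Fin (n + 1)) : GoodCover n (pull i W) := by
  obtain ⟨h1, δ, hδ, hL⟩ := h
  refine ⟨?_, δ, hδ, fun C hC hne hd => ?_⟩
  · rintro _ ⟨V, hV, rfl⟩ x hx
    exact (faceMap_mem_stdSimplex_iff i x).1 (h1 V hV hx)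
  · obtain ⟨V, hV, hCV⟩ := hL (faceMap i '' C)
      (by
        rintro _ ⟨x, hx, rfl⟩
        exact (faceMap_mem_stdSimplex_iff i x).2 (hC hx))
      (hne.image _)
      (by
        rintro _ ⟨x, hx, rfl⟩ _ ⟨y, hy, rfl⟩
        exact (dist_faceMap_le i x y).trans (hd x hx y hy))
    exact ⟨_, ⟨V, hV, rfl⟩, fun x hx => hCV ⟨x, hx, rfl⟩⟩

theorem push_mem_small {n m : ℕ} (i : Fin (n + 1)) {W : Set (Set (Fin (n + 1) → ℝ))}
    {x : FreeAbelianGroup (Fin m → (Fin n → ℝ))} (hx : x ∈ supp (small (pull i W) m)) :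
    push i x ∈ supp (small W m) := by
  refine mem_of_supp _ _ (fun τ hτ => ?_) hx
  obtain ⟨C, hC, ⟨_, ⟨V, hV, rfl⟩, hCV⟩, hτC⟩ := hτ
  rw [push, map_of_apply]
  exact of_mem_supp ⟨faceMap i '' C, hC.linear_image _, ⟨V, hV, Set.image_subset_iff.2 hCV⟩,
    fun k => ⟨_, hτC k, rfl⟩⟩

/-- The prescribed boundary is small, and it is a cycle: the chain on a codimension two face depends
only on the restricted cover, so the two contributions of each such face cancel.
`exists_small_filling` then applies, and the default value in `ell` does not occur. -/
theorem ell_spec : ∀ (n : ℕ) {W : Set (Set (Fin (n + 1) → ℝ))}, GoodCover (n + 1) W →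
    ell (n + 1) W ∈ supp (small W (n + 1)) ∧
      tbd n (ell (n + 1) W) =
        ∑ i : Fin (n + 1), (-1 : ℤ) ^ (i : ℕ) • push i (ell n (pull i W)) := by
  have key : ∀ (n : ℕ) {W : Set (Set (Fin (n + 1) → ℝ))}, (∃ c ∈ supp (small W (n + 1)),
      tbd n c = ∑ i : Fin (n + 1), (-1 : ℤ) ^ (i : ℕ) • push i (ell n (pull i W))) →
      ell (n + 1) W ∈ supp (small W (n + 1)) ∧
        tbd n (ell (n + 1) W) =
          ∑ i : Fin (n + 1), (-1 : ℤ) ^ (i : ℕ) • push i (ell n (pull i W)) := by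
    intro n W h
    have : ell (n + 1) W = h.choose := by
      rw [ell, dif_pos h]
    rw [this]
    exact h.choose_spec
  intro n
  induction n with
  | zero =>
    intro W hW
    refine key 0 ?_
    obtain ⟨-, δ, hδ, hL⟩ := hW
    obtain ⟨V, hV, hCV⟩ := hL {fun _ => 1} (by
        rintro _ rfl
        exact ⟨fun _ => zero_le_one, by simp⟩) ⟨_, rfl⟩ (by
        rintro _ rfl _ rfl
        simpa using hδ.le)
    -- The zero-dimensional simplex is the single point with coordinate `1`.
    refine ⟨of fun _ _ => 1, of_mem_supp ⟨_, convex_singleton _, ⟨V, hV, hCV⟩, fun _ => rfl⟩, ?_⟩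
    rw [tbd_of]
    refine Finset.sum_congr rfl fun i _ => ?_
    rw [ell, push, map_of_apply]
    congr 2
    exact Subsingleton.elim _ _
  | succ m ih =>
    intro W hW
    refine key (m + 1) (exists_small_filling (convex_stdSimplex ℝ _)
      (isCompact_stdSimplex ℝ _).isBounded ⟨_, single_mem_stdSimplex ℝ 0⟩ hW.1 hW.2 ?_ ?_)
    · exact sum_mem fun i _ => zsmul_mem (push_mem_small i (ih (hW.pull i)).1) _
    · rw [map_sum]
      refine (Finset.sum_congr rfl fun i _ => ?_).trans (alternating_sum_eq_zero
        (fun i j => push i (push j (ell m (pull j (pull i W))))) fun i j hij => ?_)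
      · rw [map_zsmul, push, tbd_map, (ih (hW.pull i)).2, map_sum, Finset.smul_sum]
        simp only [map_zsmul]
        rfl
      · simp only [pull_comm i j hij, push_comm i j hij]

end FreeChain

/-! ### From small tuples of points to chains of cell sets -/

namespace FreeChain

open FreeAbelianGroup

/-- The map on chains of tuples which sends a tuple to the cone over the image of its boundary,
with the vertex `top τ`. -/
def coneMap {Y Q : Type*} (top : ∀ n, (Fin (n + 1) → Y) → Q) :
    ∀ n, FreeAbelianGroup (Fin n → Y) →+ FreeAbelianGroup (Fin n → Q)
  | 0 => map fun _ i => i.elim0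
  | n + 1 => lift fun τ => tcone n (top n τ) (coneMap top n (tbd n (of τ)))

theorem coneMap_of {Y Q : Type*} (top : ∀ n, (Fin (n + 1) → Y) → Q) {n : ℕ} (τ : Fin (n + 1) → Y) :
    coneMap top (n + 1) (of τ) = tcone n (top n τ) (coneMap top n (tbd n (of τ))) := by
  simp [coneMap]

/-- As for `sd`: the chain being coned off is a cycle in positive degrees, by induction. -/
theorem tbd_coneMap {Y Q : Type*} (top : ∀ n, (Fin (n + 1) → Y) → Q) :
    ∀ (n : ℕ) (x : FreeAbelianGroup (Fin (n + 1) → Y)),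
      tbd n (coneMap top (n + 1) x) = coneMap top n (tbd n x)
  | 0, x => by
    have : (tbd 0).comp (coneMap top 1) = (coneMap top 0).comp (tbd 0) :=
      lift_ext _ _ fun τ => by
        rw [AddMonoidHom.comp_apply, coneMap_of, tbd_tcone_zero, AddMonoidHom.comp_apply]
    exact DFunLike.congr_fun this x
  | n + 1, x => by
    have : (tbd (n + 1)).comp (coneMap top (n + 2)) = (coneMap top (n + 1)).comp (tbd (n + 1)) :=
      lift_ext _ _ fun τ => by
        rw [AddMonoidHom.comp_apply, coneMap_of, tbd_tcone, AddMonoidHom.comp_apply,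
          tbd_coneMap top n, tbd_tbd, map_zero, map_zero, sub_zero]
    exact DFunLike.congr_fun this x

theorem coneMap_map {Y Q Y' Q' : Type*} (top : ∀ n, (Fin (n + 1) → Y) → Q)
    (top' : ∀ n, (Fin (n + 1) → Y') → Q') (f : Y → Y') (g : Q → Q')
    (h : ∀ n (τ : Fin (n + 1) → Y), top' n (fun i => f (τ i)) = g (top n τ)) :
    ∀ (n : ℕ) (x : FreeAbelianGroup (Fin n → Y)),
      coneMap top' n (map (fun τ i => f (τ i)) x) = map (fun τ i => g (τ i)) (coneMap top n x)
  | 0, x => by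
    simp only [coneMap, map_comp_eq]
    refine congrArg (fun t => map t x) (funext fun τ => Subsingleton.elim _ _)
  | n + 1, x => by
    have : (coneMap top' (n + 1)).comp (map fun τ i => f (τ i)) =
        (map fun τ i => g (τ i)).comp (coneMap top (n + 1)) :=
      lift_ext _ _ fun τ => by
        rw [AddMonoidHom.comp_apply, AddMonoidHom.comp_apply, coneMap_of, map_of_apply, coneMap_of,
          h, ← tcone_map, ← coneMap_map top top' f g h n, ← tbd_map, map_of_apply]
    exact DFunLike.congr_fun this x

end FreeChain

open scoped Pointwise

/-- An equivariant assignment of a non-empty set `σ x` of "cells containing `x`" to the points of a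
`G`-space, such that the points whose cells contain the given point `y` form an open set. -/
structure CellCover (G : Type*) (X S : Type*) [Group G] [TopologicalSpace X] [MulAction G X]
    [MulAction G S] where
  /-- the set of cells containing a point -/
  σ : X → Set S
  smul (g : G) (x : X) : σ (g • x) = g • σ x
  nonempty (x : X) : (σ x).Nonempty
  isOpen (y : X) : IsOpen {x | σ x ⊆ σ y}

namespace CellCover

open FreeAbelianGroup FreeChain

variable {G X S : Type*} [Group G] [TopologicalSpace X] [MulAction G X]
  [MulAction G S] (c : CellCover G X S)

/-- Strictly decreasing chains of non-empty sets of cells with a common point. -/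
def Chain (n : ℕ) : Type _ :=
  {s : Fin n → Set S // StrictAnti s ∧ ∀ k, (s k).Nonempty ∧ ∃ y, s k ⊆ c.σ y}

theorem Chain.ext {n : ℕ} {s t : c.Chain n} (h : ∀ k, s.1 k = t.1 k) : s = t :=
  Subtype.ext (funext h)

instance (n : ℕ) : MulAction G (c.Chain n) where
  smul g s := ⟨fun k => g • s.1 k, fun i j h => by
      refine lt_of_le_of_ne (Set.smul_set_mono (s.2.1 h).le) fun h' => (s.2.1 h).ne ?_
      exact smul_left_cancel g h', fun k => by
      obtain ⟨h1, y, hy⟩ := s.2.2 k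
      exact ⟨h1.smul_set, g • y, by rw [c.smul]; exact Set.smul_set_mono hy⟩⟩
  one_smul s := Chain.ext c fun k => one_smul G (s.1 k)
  mul_smul g h s := Chain.ext c fun k => mul_smul g h (s.1 k)

theorem Chain.smul_val {n : ℕ} (g : G) (s : c.Chain n) (k : Fin n) : (g • s).1 k = g • s.1 k := rfl

/-- The faces of a chain of sets of cells. -/
def chainFace {n : ℕ} (i : Fin (n + 1)) : c.Chain (n + 1) →[G] c.Chain n where
  toFun s := ⟨face i s.1, s.2.1.comp_strictMono (Fin.strictMono_succAbove i), fun _ => s.2.2 _⟩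
  map_smul' _ _ := rfl

/-! ### From tuples of points to strictly decreasing chains of sets of cells. -/

section

variable {Ω : Type*} [MulAction G Ω]

theorem hom_eq_of_apply_eq {T : Type*} [MulAction G T] [MulAction.IsPretransitive G Ω]
    {f g : Ω →[G] T} (ω : Ω) (h : f ω = g ω) : f = g := by
  refine MulActionHom.ext fun ω' => ?_
  obtain ⟨a, rfl⟩ := MulAction.exists_smul_eq G ω ω'
  rw [map_smul, map_smul, h]

/-- The union of the cells containing the entries of a tuple. -/
def top (n : ℕ) (τ : Fin (n + 1) → (Ω →[G] X)) : Ω →[G] Set S where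
  toFun ω := ⋃ k, c.σ (τ k ω)
  map_smul' g ω := by
    simp only [map_smul, c.smul, id, Set.smul_set_iUnion]

/-- Tuples of equivariant maps to `Set S` which are decreasing chains of non-empty subsets
of `U`. -/
def descending (U : Ω → Set S) (n : ℕ) : Set (Fin n → (Ω →[G] Set S)) :=
  {s | ∀ ω, Antitone (fun k => s k ω) ∧ ∀ k, (s k ω).Nonempty ∧ s k ω ⊆ U ω}

/-- The union attached to `τ` contains the unions attached to its faces, so coning prepends a larger
set. The induction takes `U` to be that union. -/
theorem coneMap_top_mem : ∀ {n : ℕ} {τ : Fin n → (Ω →[G] X)} {U : Ω → Set S},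
    (∀ k ω, c.σ (τ k ω) ⊆ U ω) → coneMap c.top n (of τ) ∈ supp (descending (G := G) U n)
  | 0, τ, U, _ => by
    rw [coneMap, map_of_apply]
    exact of_mem_supp fun ω => ⟨fun i => i.elim0, fun i => i.elim0⟩
  | n + 1, τ, U, h => by
    rw [coneMap_of]
    refine tcone_mem_supp (S := descending (fun ω => c.top n τ ω) n) (S' := descending U (n + 1))
      (fun s hs ω => ⟨?_, ?_⟩) ?_
    · intro i j hij
      refine Fin.cases (fun hij => ?_) (fun i hij => ?_) i hij <;>
        refine Fin.cases (fun hij => ?_) (fun j hij => ?_) j hij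
      · exact le_rfl
      · exact ((hs ω).2 j).2
      · simp at hij
      · exact (hs ω).1 (Fin.succ_le_succ_iff.1 hij)
    · have hU : c.top n τ ω ⊆ U ω := Set.iUnion_subset fun k => h k ω
      refine Fin.cases ?_ fun k => ?_
      · exact ⟨(c.nonempty _).mono (Set.subset_iUnion (fun k => c.σ (τ k ω)) 0), hU⟩
      · exact ⟨((hs ω).2 k).1, ((hs ω).2 k).2.trans hU⟩
    · rw [tbd_of, map_sum]
      refine sum_mem fun i _ => ?_
      rw [map_zsmul]
      refine zsmul_mem (coneMap_top_mem fun k ω => ?_) _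
      exact Set.subset_iUnion (fun k => c.σ (τ k ω)) (i.succAbove k)

/-- A tuple of equivariant maps to `Set S` whose values are strictly decreasing chains. -/
def mkChain {n : ℕ} (s : Fin n → (Ω →[G] Set S))
    (h : ∀ ω, StrictAnti (fun k => s k ω) ∧ ∀ k, (s k ω).Nonempty ∧ ∃ y, s k ω ⊆ c.σ y) :
    Ω →[G] c.Chain n where
  toFun ω := ⟨fun k => s k ω, h ω⟩
  map_smul' g ω := Chain.ext c fun k => map_smul (s k) g ω

open Classical in
/-- The projection from chains of tuples of sets of cells to strictly decreasing chains. -/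
noncomputable def pr (n : ℕ) :
    FreeAbelianGroup (Fin n → (Ω →[G] Set S)) →+ FreeAbelianGroup (Ω →[G] c.Chain n) :=
  lift fun s =>
    if h : ∀ ω, StrictAnti (fun k => s k ω) ∧ ∀ k, (s k ω).Nonempty ∧ ∃ y, s k ω ⊆ c.σ y then
      of (c.mkChain s h)
    else 0

theorem pr_of {n : ℕ} {s : Fin n → (Ω →[G] Set S)}
    (h : ∀ ω, StrictAnti (fun k => s k ω) ∧ ∀ k, (s k ω).Nonempty ∧ ∃ y, s k ω ⊆ c.σ y) :
    c.pr n (of s) = of (c.mkChain s h) := by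
  rw [pr, lift_apply_of, dif_pos h]

theorem pr_of_not {n : ℕ} {s : Fin n → (Ω →[G] Set S)}
    (h : ¬ ∀ ω, StrictAnti (fun k => s k ω) ∧ ∀ k, (s k ω).Nonempty ∧ ∃ y, s k ω ⊆ c.σ y) :
    c.pr n (of s) = 0 := by
  rw [pr, lift_apply_of, dif_neg h]

/-- The boundary operator on chains of cell sets. -/
def chainBd (Ω : Type*) [MulAction G Ω] (n : ℕ) :
    FreeAbelianGroup (Ω →[G] c.Chain (n + 1)) →+ FreeAbelianGroup (Ω →[G] c.Chain n) :=
  bd fun i s => (c.chainFace i).comp s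

/-- The point is that descending tuples with a repetition form a subcomplex. Transitivity of `G` on
`Ω` turns a repetition at one point into equality of two consecutive maps. The hypothesis on `U`
supplies the common point required of chains. -/
theorem pr_tbd [MulAction.IsPretransitive G Ω] {n : ℕ} {U : Ω → Set S}
    (hU : ∀ ω, ∃ y, U ω ⊆ c.σ y)
    {x : FreeAbelianGroup (Fin (n + 1) → (Ω →[G] Set S))}
    (hx : x ∈ supp (descending U (n + 1))) :
    c.pr n (tbd n x) = c.chainBd Ω n (c.pr (n + 1) x) := by
  refine eq_of_supp ((c.pr n).comp (tbd n)) ((c.chainBd Ω n).comp (c.pr (n + 1)))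
    (fun s hs => ?_) hx
  rw [AddMonoidHom.comp_apply, AddMonoidHom.comp_apply, tbd_of, map_sum]
  by_cases h : ∀ ω, StrictAnti (fun k => s k ω) ∧ ∀ k, (s k ω).Nonempty ∧ ∃ y, s k ω ⊆ c.σ y
  · rw [pr_of c h, chainBd, bd_of]
    refine Finset.sum_congr rfl fun i _ => ?_
    rw [map_zsmul, pr_of c (s := face i s) fun ω =>
      ⟨(h ω).1.comp_strictMono (Fin.strictMono_succAbove i), fun _ => (h ω).2 _⟩]
    rfl
  · rw [pr_of_not c h, map_zero]
    have h' : ∃ ω, ¬ StrictAnti (fun k => s k ω) := by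
      by_contra! h'
      refine h fun ω => ⟨h' ω, fun k => ⟨((hs ω).2 k).1, ?_⟩⟩
      obtain ⟨y, hy⟩ := hU ω
      exact ⟨y, ((hs ω).2 k).2.trans hy⟩
    obtain ⟨ω, hω⟩ := h'
    obtain ⟨k, hk⟩ : ∃ k : Fin n, s k.castSucc = s k.succ := by
      by_contra! h'
      refine hω (Fin.strictAnti_iff_succ_lt.2 fun k => ?_)
      exact lt_of_le_of_ne ((hs ω).1 (Fin.castSucc_le_succ k))
        fun h'' => h' k (hom_eq_of_apply_eq ω h''.symm)
    -- The two faces omitting one of the equal entries coincide and have opposite signs; every other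
    -- face still has a repetition and is killed by `pr`.
    rw [Finset.sum_eq_add k.castSucc k.succ (Fin.castSucc_lt_succ).ne (fun i _ hi => ?_)
      (by simp) (by simp)]
    · have hf : face k.castSucc s = face k.succ s := by
        funext l
        simp only [face]
        rcases lt_trichotomy l k with hl | rfl | hl
        · rw [Fin.succAbove_of_castSucc_lt _ _ (Fin.castSucc_lt_castSucc_iff.2 hl),
            Fin.succAbove_of_castSucc_lt _ _ ((Fin.castSucc_lt_castSucc_iff.2 hl).trans
              Fin.castSucc_lt_succ)]
        · rw [Fin.succAbove_castSucc_self, Fin.succAbove_succ_self, hk]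
        · rw [Fin.succAbove_of_le_castSucc _ _ (Fin.castSucc_le_castSucc_iff.2 hl.le),
            Fin.succAbove_of_le_castSucc _ _ (Fin.succ_le_castSucc_iff.2 hl)]
      rw [hf, Fin.val_succ, Fin.val_castSucc, pow_succ, mul_neg_one, neg_smul, map_neg,
        add_neg_cancel]
    · rw [map_zsmul, pr_of_not, smul_zero]
      intro h'
      obtain ⟨a, ha⟩ := Fin.exists_succAbove_eq hi.1.symm
      obtain ⟨b, hb⟩ := Fin.exists_succAbove_eq hi.2.symm
      have hab : a = b := (h' ω).1.injective (by simp only [face, ha, hb, hk])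
      rw [← hab, ha] at hb
      exact (Fin.castSucc_lt_succ (i := k)).ne hb

variable {Ω' : Type*} [MulAction G Ω']

/-- Precomposition with an equivariant map. -/
def precomp {T : Type*} [MulAction G T] (r : Ω' →[G] Ω) (s : Ω →[G] T) : Ω' →[G] T := s.comp r

theorem pr_map {n : ℕ} (r : Ω' →[G] Ω) (hr : Function.Surjective r)
    (x : FreeAbelianGroup (Fin n → (Ω →[G] Set S))) :
    c.pr n (map (fun s k => precomp r (s k)) x) = map (precomp r) (c.pr n x) := by
  have : (c.pr n).comp (map fun s k => precomp r (s k)) =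
      (map (precomp r)).comp (c.pr (Ω := Ω) n) := by
    refine lift_ext _ _ fun s => ?_
    rw [AddMonoidHom.comp_apply, AddMonoidHom.comp_apply, map_of_apply]
    by_cases h : ∀ ω, StrictAnti (fun k => s k ω) ∧ ∀ k, (s k ω).Nonempty ∧ ∃ y, s k ω ⊆ c.σ y
    · rw [pr_of c h, map_of_apply, pr_of c fun ω => h (r ω)]
      rfl
    · rw [pr_of_not c h, map_zero, pr_of_not]
      intro h'
      refine h fun ω => ?_
      obtain ⟨ω', rfl⟩ := hr ω
      exact h' ω'
  exact DFunLike.congr_fun this x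

end

end CellCover

/-! ### From singular simplices to small tuples of points -/

namespace CellCover

open FreeAbelianGroup FreeChain

/-- The inclusion of a face of the standard simplex. -/
def simplexFace {n : ℕ} (i : Fin (n + 1)) :
    C(stdSimplex ℝ (Fin n), stdSimplex ℝ (Fin (n + 1))) where
  toFun t := ⟨faceMap i t.1, (faceMap_mem_stdSimplex_iff i t.1).2 t.2⟩
  continuous_toFun := ((faceMap i).continuous_of_finiteDimensional.comp
    continuous_subtype_val).subtype_mk _

variable {G X S : Type*} [Group G] [TopologicalSpace X] [MulAction G X] [ContinuousConstSMul G X]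
  [MulAction G S]

variable (G X) in
/-- The faces of a singular simplex. -/
def singFace {n : ℕ} (i : Fin (n + 1)) :
    C(stdSimplex ℝ (Fin (n + 1)), X) →[G] C(stdSimplex ℝ (Fin n), X) where
  toFun f := f.comp (simplexFace i)
  map_smul' _ _ := rfl

theorem singFace_singFace {m : ℕ} (i j : Fin (m + 1)) (h : i ≤ j)
    (f : C(stdSimplex ℝ (Fin (m + 2)), X)) :
    singFace G X i (singFace G X j.succ f) = singFace G X j (singFace G X i.castSucc f) := by
  ext t
  exact congrArg f (Subtype.ext (faceMap_comm i j h t.1))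

variable (X) in
/-- The boundary operator on equivariant families of singular simplices. -/
def singBd (Ω : Type*) [MulAction G Ω] (n : ℕ) :
    FreeAbelianGroup (Ω →[G] C(stdSimplex ℝ (Fin (n + 1)), X)) →+
      FreeAbelianGroup (Ω →[G] C(stdSimplex ℝ (Fin n), X)) :=
  bd fun i s => (singFace G X i).comp s

section

variable (c : CellCover G X S) {Ω : Type*} [MulAction G Ω]

open Classical in
/-- A retraction to the standard simplex. -/
noncomputable def toSimplex {n : ℕ} (p : Fin (n + 1) → ℝ) : stdSimplex ℝ (Fin (n + 1)) :=
  if h : p ∈ stdSimplex ℝ (Fin (n + 1)) then ⟨p, h⟩ else ⟨_, single_mem_stdSimplex ℝ 0⟩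

theorem toSimplex_of_mem {n : ℕ} {p : Fin (n + 1) → ℝ} (h : p ∈ stdSimplex ℝ (Fin (n + 1))) :
    toSimplex p = ⟨p, h⟩ := dif_pos h

/-- Evaluation of an equivariant family of singular simplices at a point. -/
noncomputable def ev {n : ℕ} (F : Ω →[G] C(stdSimplex ℝ (Fin (n + 1)), X))
    (p : Fin (n + 1) → ℝ) : Ω →[G] X where
  toFun ω := F ω (toSimplex p)
  map_smul' g ω := by
    rw [map_smul]
    rfl

/-- The cover of the standard simplex induced by an equivariant family of singular simplices. -/
def coverOf {n : ℕ} (F : Ω →[G] C(stdSimplex ℝ (Fin n), X)) : Set (Set (Fin n → ℝ)) :=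
  {V | ∃ ω y, V = {p | ∃ h : p ∈ stdSimplex ℝ (Fin n), c.σ (F ω ⟨p, h⟩) ⊆ c.σ y}}

theorem coverOf_face {n : ℕ} (F : Ω →[G] C(stdSimplex ℝ (Fin (n + 1)), X)) (i : Fin (n + 1)) :
    c.coverOf ((singFace G X i).comp F) = pull i (c.coverOf F) := by
  have key : ∀ ω y, {p | ∃ h : p ∈ stdSimplex ℝ (Fin n),
      c.σ ((singFace G X i).comp F ω ⟨p, h⟩) ⊆ c.σ y} = faceMap i ⁻¹'
      {p | ∃ h : p ∈ stdSimplex ℝ (Fin (n + 1)), c.σ (F ω ⟨p, h⟩) ⊆ c.σ y} := by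
    intro ω y
    ext p
    exact ⟨fun ⟨h, h'⟩ => ⟨(faceMap_mem_stdSimplex_iff i p).2 h, h'⟩,
      fun ⟨h, h'⟩ => ⟨(faceMap_mem_stdSimplex_iff i p).1 h, h'⟩⟩
  ext V
  constructor
  · rintro ⟨ω, y, rfl⟩
    exact ⟨_, ⟨ω, y, rfl⟩, (key ω y).symm⟩
  · rintro ⟨_, ⟨ω, y, rfl⟩, rfl⟩
    exact ⟨ω, y, (key ω y).symm⟩

/-- Each `x` lies in the open set `{z | σ z ⊆ σ x}`, so these sets cover the compact simplex. The
sets belonging to a single `ω` already suffice. -/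
theorem goodCover_coverOf [Nonempty Ω] {n : ℕ} (F : Ω →[G] C(stdSimplex ℝ (Fin n), X)) :
    GoodCover n (c.coverOf F) := by
  refine ⟨?_, ?_⟩
  · rintro _ ⟨ω, y, rfl⟩ p ⟨h, -⟩
    exact h
  · obtain ⟨ω⟩ := ‹Nonempty Ω›
    obtain ⟨δ, hδ, h⟩ := lebesgue_number_lemma_of_metric (s := Set.univ)
      (c := fun y => F ω ⁻¹' {x | c.σ x ⊆ c.σ y}) isCompact_univ
      (fun y => (c.isOpen y).preimage (F ω).continuous)
      (fun t _ => Set.mem_iUnion.2 ⟨F ω t, Set.Subset.refl (c.σ (F ω t))⟩)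
    -- Halving turns the weak inequality in `HasLebesgue` into membership in an open ball of radius
    -- `δ`.
    refine ⟨δ / 2, half_pos hδ, fun C hC hne hd => ?_⟩
    obtain ⟨p, hp⟩ := hne
    obtain ⟨y, hy⟩ := h ⟨p, hC hp⟩ trivial
    refine ⟨_, ⟨ω, y, rfl⟩, fun p' hp' => ⟨hC hp', hy ?_⟩⟩
    exact (hd p' hp' p hp).trans_lt (half_lt_self hδ)

theorem coverOf_precomp {Ω' : Type*} [MulAction G Ω'] {n : ℕ} (r : Ω' →[G] Ω)
    (hr : Function.Surjective r) (F : Ω →[G] C(stdSimplex ℝ (Fin n), X)) :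
    c.coverOf (precomp r F) = c.coverOf F := by
  ext V
  constructor
  · rintro ⟨ω, y, rfl⟩
    exact ⟨r ω, y, rfl⟩
  · rintro ⟨ω, y, rfl⟩
    obtain ⟨ω', rfl⟩ := hr ω
    exact ⟨ω', y, rfl⟩

/-- Fine subdivision of equivariant families of singular simplices. -/
noncomputable def subdivide : ∀ n,
    FreeAbelianGroup (Ω →[G] C(stdSimplex ℝ (Fin n), X)) →+ FreeAbelianGroup (Fin n → (Ω →[G] X))
  | 0 => map fun _ i => i.elim0
  | n + 1 => lift fun F => map (fun τ k => ev F (τ k)) (ell (n + 1) (c.coverOf F))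

theorem subdivide_of {n : ℕ} (F : Ω →[G] C(stdSimplex ℝ (Fin (n + 1)), X)) :
    c.subdivide (n + 1) (of F) = map (fun τ k => ev F (τ k)) (ell (n + 1) (c.coverOf F)) := by
  simp [subdivide]

/-- The cover of a face of `F` is the restriction of the cover of `F`, so the coherence built into
`ell` is exactly compatibility with faces. -/
theorem tbd_subdivide [Nonempty Ω] (n : ℕ)
    (x : FreeAbelianGroup (Ω →[G] C(stdSimplex ℝ (Fin (n + 1)), X))) :
    tbd n (c.subdivide (n + 1) x) = c.subdivide n (singBd X Ω n x) := by
  have : (tbd n).comp (c.subdivide (n + 1)) = (c.subdivide n).comp (singBd X Ω n) := by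
    refine lift_ext _ _ fun F => ?_
    rw [AddMonoidHom.comp_apply, AddMonoidHom.comp_apply, subdivide_of, tbd_map,
      (ell_spec n (c.goodCover_coverOf F)).2, singBd, bd_of, map_sum, map_sum]
    refine Finset.sum_congr rfl fun i _ => ?_
    rw [map_zsmul, map_zsmul, ← c.coverOf_face F i]
    refine congrArg _ ?_
    rw [push, map_comp_eq]
    cases n with
    | zero =>
      rw [ell, map_of_apply, subdivide, map_of_apply]
      exact congrArg of (Subsingleton.elim _ _)
    | succ m =>
      rw [subdivide_of]
      -- On small tuples the entries lie in the simplex, where `toSimplex` changes nothing.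
      refine eq_of_supp _ _ (fun τ hτ => ?_)
        (ell_spec m (c.goodCover_coverOf ((singFace G X i).comp F))).1
      obtain ⟨C, -, ⟨V, hV, hCV⟩, hτC⟩ := hτ
      rw [map_of_apply, map_of_apply]
      refine congrArg of (funext fun k => MulActionHom.ext fun ω => ?_)
      have h1 : τ k ∈ stdSimplex ℝ (Fin (m + 1)) :=
        (c.goodCover_coverOf _).1 V hV (hCV (hτC k))
      have h2 := (faceMap_mem_stdSimplex_iff i (τ k)).2 h1
      show F ω (toSimplex (faceMap i (τ k))) = F ω (simplexFace i (toSimplex (τ k)))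
      rw [toSimplex_of_mem h1, toSimplex_of_mem h2]
      rfl
  exact DFunLike.congr_fun this x

/-- Tuples of equivariant maps whose values have cells contained in a common set `c.σ y`. -/
def smallTuples (Ω : Type*) [MulAction G Ω] (n : ℕ) : Set (Fin n → (Ω →[G] X)) :=
  {τ | ∀ ω, ∃ y, ∀ k, c.σ (τ k ω) ⊆ c.σ y}

theorem subdivide_mem [Nonempty Ω] [MulAction.IsPretransitive G Ω] {n : ℕ}
    (x : FreeAbelianGroup (Ω →[G] C(stdSimplex ℝ (Fin (n + 1)), X))) :
    c.subdivide (n + 1) x ∈ supp (c.smallTuples Ω (n + 1)) := by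
  refine mem_of_supp _ _ (fun F _ => ?_) (mem_supp_univ x)
  rw [subdivide_of]
  refine mem_of_supp _ _ (fun τ hτ => ?_) (ell_spec n (c.goodCover_coverOf F)).1
  obtain ⟨C, -, ⟨V, ⟨ω₀, y, rfl⟩, hCV⟩, hτC⟩ := hτ
  rw [map_of_apply]
  refine of_mem_supp fun ω => ?_
  -- Smallness is known at `ω₀`; equivariance carries it to every other point, with `y` replaced by
  -- `g • y`.
  obtain ⟨g, rfl⟩ := MulAction.exists_smul_eq G ω₀ ω
  refine ⟨g • y, fun k => ?_⟩
  obtain ⟨h, h'⟩ := hCV (hτC k)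
  rw [map_smul, c.smul, c.smul]
  refine Set.smul_set_mono ?_
  show c.σ (F ω₀ (toSimplex (τ k))) ⊆ c.σ y
  rwa [toSimplex_of_mem h]

/-- Precomposition with a surjection leaves the induced cover unchanged, hence also the chosen
linear chain `ell`. This is what makes the choices natural. -/
theorem subdivide_map {Ω' : Type*} [MulAction G Ω'] (r : Ω' →[G] Ω)
    (hr : Function.Surjective r) : ∀ (n : ℕ)
    (x : FreeAbelianGroup (Ω →[G] C(stdSimplex ℝ (Fin n), X))),
    c.subdivide n (map (precomp r) x) = map (fun τ k => precomp r (τ k)) (c.subdivide n x)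
  | 0, x => by
    simp only [subdivide, map_comp_eq]
    exact congrArg (fun t => map t x) (funext fun τ => Subsingleton.elim _ _)
  | n + 1, x => by
    have : (c.subdivide (n + 1)).comp (map (precomp r)) =
        (map fun (τ : Fin (n + 1) → (Ω →[G] X)) k => precomp r (τ k)).comp
          (c.subdivide (Ω := Ω) (n + 1)) := by
      refine lift_ext _ _ fun F => ?_
      rw [AddMonoidHom.comp_apply, AddMonoidHom.comp_apply, map_of_apply, subdivide_of,
        subdivide_of, c.coverOf_precomp r hr, map_comp_eq]
      rfl
    exact DFunLike.congr_fun this x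

/-- The map from singular chains to chains of sets of cells. -/
noncomputable def toChain (Ω : Type*) [MulAction G Ω] (n : ℕ) :
    FreeAbelianGroup (Ω →[G] C(stdSimplex ℝ (Fin n), X)) →+ FreeAbelianGroup (Ω →[G] c.Chain n) :=
  (c.pr n).comp ((coneMap c.top n).comp (c.subdivide n))

/-- `pr` commutes with boundaries only on descending tuples below some `σ y`; the smallness of the
subdivision ensures that only these arise. -/
theorem toChain_singBd [Nonempty Ω] [MulAction.IsPretransitive G Ω] {n : ℕ}
    (x : FreeAbelianGroup (Ω →[G] C(stdSimplex ℝ (Fin (n + 1)), X))) :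
    c.toChain Ω n (singBd X Ω n x) = c.chainBd Ω n (c.toChain Ω (n + 1) x) := by
  simp only [toChain, AddMonoidHom.comp_apply]
  rw [← tbd_subdivide, ← tbd_coneMap]
  refine eq_of_supp (((c.pr n).comp (tbd n)).comp (coneMap c.top (n + 1)))
    (((c.chainBd Ω n).comp (c.pr (n + 1))).comp (coneMap c.top (n + 1))) (fun τ hτ => ?_)
    (c.subdivide_mem x)
  choose y hy using hτ
  exact c.pr_tbd (fun ω => ⟨y ω, subset_rfl⟩) (c.coneMap_top_mem fun k ω => hy ω k)

theorem toChain_map {Ω' : Type*} [MulAction G Ω'] (r : Ω' →[G] Ω)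
    (hr : Function.Surjective r) (n : ℕ)
    (x : FreeAbelianGroup (Ω →[G] C(stdSimplex ℝ (Fin n), X))) :
    c.toChain Ω' n (map (precomp r) x) = map (precomp r) (c.toChain Ω n x) := by
  simp only [toChain, AddMonoidHom.comp_apply]
  rw [subdivide_map c r hr, coneMap_map c.top c.top (precomp r) (precomp r) fun _ _ => rfl,
    pr_map c r hr]

end

end CellCover

/-! ### Acyclicity of singular chains of contractible fixed point spaces -/

/-- The equivariant map `G/H → T` determined by a fixed point of `H`. -/
def MulAction.homOfFixed {G T : Type*} [Group G] [MulAction G T] (H : Subgroup G) (t : T)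
    (ht : ∀ h ∈ H, h • t = t) : (G ⧸ H) →[G] T where
  toFun q := Quotient.liftOn' q (fun g => g • t) fun a b hab => by
    have h1 := ht _ (QuotientGroup.leftRel_apply.1 hab)
    rw [mul_smul, inv_smul_eq_iff] at h1
    exact h1.symm
  map_smul' g q := by
    induction q using QuotientGroup.induction_on with
    | H a => exact mul_smul g a t

theorem MulAction.homOfFixed_apply {G T : Type*} [Group G] [MulAction G T] (H : Subgroup G) (t : T)
    (ht : ∀ h ∈ H, h • t = t) (g : G) : MulAction.homOfFixed H t ht (g : G ⧸ H) = g • t := rfl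

theorem MulAction.smul_hom_one {G T : Type*} [Group G] [MulAction G T] {H : Subgroup G}
    (f : (G ⧸ H) →[G] T) (h : G) (hh : h ∈ H) :
    h • f ((1 : G) : G ⧸ H) = f ((1 : G) : G ⧸ H) := by
  rw [← map_smul]
  congr 1
  rw [MulAction.Quotient.smul_coe, QuotientGroup.eq]
  simpa using hh

namespace FreeChain

open FreeAbelianGroup CellCover

/-! ### Cones over singular simplices of a contractible space. -/

section Cone

variable {Y : Type*} [TopologicalSpace Y] {y₀ : Y}

/-- Projection from a vertex of the simplex to the opposite face. -/
noncomputable def tailPoint {n : ℕ} (t : stdSimplex ℝ (Fin (n + 1))) (h : t.1 0 ≤ 1 / 2) :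
    stdSimplex ℝ (Fin n) :=
  ⟨fun k => t.1 k.succ / (1 - t.1 0), fun k => div_nonneg (t.2.1 _) (by linarith), by
    have h1 := t.2.2
    rw [Fin.sum_univ_succ] at h1
    rw [← Finset.sum_div, div_eq_one_iff_eq (by linarith)]
    linarith⟩

open Classical in
/-- The function underlying the cone over a singular simplex. -/
noncomputable def hatFun (h : (ContinuousMap.id Y).Homotopy (ContinuousMap.const Y y₀)) {n : ℕ}
    (f : C(stdSimplex ℝ (Fin n), Y)) (t : stdSimplex ℝ (Fin (n + 1))) : Y :=
  -- The contraction is completed at `t 0 = 1 / 2`, so the division by `1 - t 0` in `tailPoint` is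
  -- avoided near the cone vertex, and continuity there is automatic.
  if ht : t.1 0 ≤ 1 / 2 then
    h (⟨2 * t.1 0, by linarith [t.2.1 0], by linarith⟩, f (tailPoint t ht))
  else y₀

theorem hatFun_of_le (h : (ContinuousMap.id Y).Homotopy (ContinuousMap.const Y y₀)) {n : ℕ}
    (f : C(stdSimplex ℝ (Fin n), Y)) (t : stdSimplex ℝ (Fin (n + 1))) (ht : t.1 0 ≤ 1 / 2) :
    hatFun h f t = h (⟨2 * t.1 0, by linarith [t.2.1 0], by linarith⟩, f (tailPoint t ht)) :=
  dif_pos ht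

theorem hatFun_of_ge (h : (ContinuousMap.id Y).Homotopy (ContinuousMap.const Y y₀)) {n : ℕ}
    (f : C(stdSimplex ℝ (Fin n), Y)) (t : stdSimplex ℝ (Fin (n + 1))) (ht : 1 / 2 ≤ t.1 0) :
    hatFun h f t = y₀ := by
  rcases ht.eq_or_lt with h' | h'
  · rw [hatFun_of_le h f t h'.symm.le]
    have : (⟨2 * t.1 0, by linarith [t.2.1 0], by linarith⟩ : unitInterval) = 1 :=
      Subtype.ext (show 2 * t.1 0 = 1 by linarith)
    rw [this]
    simp
  · exact dif_neg (not_le.2 h')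

theorem continuous_coord {n : ℕ} (k : Fin n) :
    Continuous fun t : stdSimplex ℝ (Fin n) => t.1 k :=
  (continuous_apply k).comp continuous_subtype_val

theorem continuous_hatFun (h : (ContinuousMap.id Y).Homotopy (ContinuousMap.const Y y₀)) {n : ℕ}
    (f : C(stdSimplex ℝ (Fin n), Y)) : Continuous (hatFun h f) := by
  have hA : IsClosed {t : stdSimplex ℝ (Fin (n + 1)) | t.1 0 ≤ 1 / 2} :=
    isClosed_le (continuous_coord 0) continuous_const
  have hB : IsClosed {t : stdSimplex ℝ (Fin (n + 1)) | 1 / 2 ≤ t.1 0} :=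
    isClosed_le continuous_const (continuous_coord 0)
  have hu : {t : stdSimplex ℝ (Fin (n + 1)) | t.1 0 ≤ 1 / 2} ∪ {t | 1 / 2 ≤ t.1 0} = Set.univ :=
    Set.eq_univ_of_forall fun t => le_total (t.1 0) (1 / 2)
  rw [← continuousOn_univ, ← hu]
  refine ContinuousOn.union_of_isClosed ?_ ?_ hA hB
  · rw [continuousOn_iff_continuous_domRestrict]
    have hc : ∀ k, Continuous fun t : {t : stdSimplex ℝ (Fin (n + 1)) | t.1 0 ≤ 1 / 2} =>
        t.1.1 k := fun k => (continuous_coord k).comp continuous_subtype_val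
    have : Continuous fun t : {t : stdSimplex ℝ (Fin (n + 1)) | t.1 0 ≤ 1 / 2} =>
        h ((⟨2 * t.1.1 0, by linarith [t.1.2.1 0], by linarith [t.2.out]⟩ : unitInterval),
          f (tailPoint t.1 t.2)) := by
      refine h.continuous.comp (Continuous.prodMk ?_ (f.continuous.comp ?_))
      · exact (continuous_const.mul (hc 0)).subtype_mk _
      · refine Continuous.subtype_mk (continuous_pi fun k => ?_) _
        exact (hc _).div (continuous_const.sub (hc 0)) fun t => by linarith [t.2.out]
    refine this.congr fun t => ?_
    exact (hatFun_of_le h f t.1 t.2).symm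
  · refine (continuousOn_const (c := y₀)).congr fun t ht => ?_
    exact hatFun_of_ge h f t ht

/-- The cone over a singular simplex with respect to a contraction. -/
noncomputable def hat (h : (ContinuousMap.id Y).Homotopy (ContinuousMap.const Y y₀)) {n : ℕ}
    (f : C(stdSimplex ℝ (Fin n), Y)) : C(stdSimplex ℝ (Fin (n + 1)), Y) :=
  ⟨hatFun h f, continuous_hatFun h f⟩

theorem hat_face_zero (h : (ContinuousMap.id Y).Homotopy (ContinuousMap.const Y y₀)) {n : ℕ}
    (f : C(stdSimplex ℝ (Fin n), Y)) : (hat h f).comp (simplexFace 0) = f := by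
  ext t
  have h0 : (simplexFace 0 t).1 0 = 0 := faceMap_self 0 t.1
  show hatFun h f _ = _
  rw [hatFun_of_le h f _ (by rw [h0]; norm_num)]
  have h1 : (⟨2 * (simplexFace 0 t).1 0, by rw [h0]; norm_num, by rw [h0]; norm_num⟩ :
      unitInterval) = 0 := Subtype.ext (show 2 * (simplexFace 0 t).1 0 = 0 by rw [h0, mul_zero])
  rw [h1, h.apply_zero]
  refine congrArg f (Subtype.ext (funext fun k => ?_))
  show (simplexFace 0 t).1 k.succ / (1 - (simplexFace 0 t).1 0) = t.1 k
  rw [h0, sub_zero, div_one]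
  have := faceMap_succAbove 0 t.1 k
  rwa [Fin.zero_succAbove] at this

/-- Projection from vertex zero commutes with the inclusions of the faces containing that vertex, by
linearity of `faceMap`. -/
theorem hat_face_succ (h : (ContinuousMap.id Y).Homotopy (ContinuousMap.const Y y₀)) {n : ℕ}
    (f : C(stdSimplex ℝ (Fin (n + 1)), Y)) (i : Fin (n + 1)) :
    (hat h f).comp (simplexFace i.succ) = hat h (f.comp (simplexFace i)) := by
  ext t
  have h0 : (simplexFace i.succ t).1 0 = t.1 0 := by
    have := faceMap_succAbove i.succ t.1 0
    rwa [Fin.succ_succAbove_zero] at this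
  have hs : ∀ k : Fin (n + 1), (simplexFace i.succ t).1 k.succ =
      faceMap i (fun l => t.1 l.succ) k := by
    intro k
    refine Fin.succAboveCases i ?_ (fun k => ?_) k
    · rw [faceMap_self]
      exact faceMap_self i.succ t.1
    · rw [faceMap_succAbove, ← Fin.succ_succAbove_succ]
      exact faceMap_succAbove i.succ t.1 k.succ
  show hatFun h f _ = hatFun h _ t
  rcases le_total (t.1 0) (1 / 2) with ht | ht
  · rw [hatFun_of_le h f _ (by rw [h0]; exact ht), hatFun_of_le h _ t ht]
    refine congrArg h (Prod.ext (Subtype.ext (congrArg (2 * ·) h0)) ?_)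
    · refine congrArg f (Subtype.ext (funext fun k => ?_))
      show (simplexFace i.succ t).1 k.succ / (1 - (simplexFace i.succ t).1 0) =
        faceMap i (tailPoint t ht).1 k
      rw [h0, hs]
      have : (tailPoint t ht).1 = (1 - t.1 0)⁻¹ • fun l => t.1 (Fin.succ l) := by
        funext l
        exact div_eq_inv_mul _ _
      rw [this, map_smul, Pi.smul_apply, smul_eq_mul, div_eq_inv_mul]
  · rw [hatFun_of_ge h f _ (by rw [h0]; exact ht), hatFun_of_ge h _ t ht]

end Cone

/-- A semi-simplicial set with an extra degeneracy has an acyclic augmented chain complex. -/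
theorem exact_of_extra {T : ℕ → Type*} (d : ∀ n, Fin (n + 1) → T (n + 1) → T n)
    (s : ∀ n, T n → T (n + 1)) (h0 : ∀ n t, d n 0 (s n t) = t)
    (hs : ∀ n (i : Fin (n + 1)) t, d (n + 1) i.succ (s (n + 1) t) = s n (d n i t)) :
    (∀ x : FreeAbelianGroup (T 0), ∃ y, bd (d 0) y = x) ∧
    ∀ n (x : FreeAbelianGroup (T (n + 1))), bd (d n) x = 0 → ∃ y, bd (d (n + 1)) y = x := by
  refine ⟨fun x => ⟨map (s 0) x, ?_⟩, fun n x hx => ⟨map (s (n + 1)) x, ?_⟩⟩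
  · have : (bd (d 0)).comp (map (s 0)) = AddMonoidHom.id _ :=
      lift_ext _ _ fun t => by
        rw [AddMonoidHom.comp_apply, map_of_apply, bd_of]
        simp [h0]
    exact DFunLike.congr_fun this x
  · have : (bd (d (n + 1))).comp (map (s (n + 1))) =
        AddMonoidHom.id _ - (map (s n)).comp (bd (d n)) :=
      lift_ext _ _ fun t => by
        rw [AddMonoidHom.comp_apply, map_of_apply, bd_of, Fin.sum_univ_succ,
          AddMonoidHom.sub_apply, AddMonoidHom.comp_apply, bd_of, map_sum, sub_eq_add_neg,
          ← Finset.sum_neg_distrib]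
        refine congrArg₂ (· + ·) (by simp [h0]) (Finset.sum_congr rfl fun i _ => ?_)
        rw [Fin.val_succ, pow_succ, mul_neg_one, neg_smul, map_zsmul, map_of_apply, hs]
    refine (DFunLike.congr_fun this x).trans ?_
    rw [AddMonoidHom.sub_apply, AddMonoidHom.comp_apply, hx, map_zero, sub_zero]
    rfl

end FreeChain

/-! ### Equivariant singular chains and fixed point spaces. -/

namespace CellCover

open FreeAbelianGroup FreeChain

variable {G X : Type*} [Group G] [TopologicalSpace X] [MulAction G X] [ContinuousConstSMul G X]

/-- The singular simplex of the fixed point space given by an equivariant family. -/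
def toFixed {H : Subgroup G} {n : ℕ} (F : (G ⧸ H) →[G] C(stdSimplex ℝ (Fin n), X)) :
    C(stdSimplex ℝ (Fin n), MulAction.fixedPoints H X) where
  toFun t := ⟨F ((1 : G) : G ⧸ H) t, fun h =>
    DFunLike.congr_fun (MulAction.smul_hom_one F h.1 h.2) t⟩
  continuous_toFun := (F ((1 : G) : G ⧸ H)).continuous.subtype_mk _

/-- The equivariant family given by a singular simplex of the fixed point space. -/
def ofFixed {H : Subgroup G} {n : ℕ} (f : C(stdSimplex ℝ (Fin n), MulAction.fixedPoints H X)) :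
    (G ⧸ H) →[G] C(stdSimplex ℝ (Fin n), X) :=
  MulAction.homOfFixed H ⟨fun t => (f t).1, continuous_subtype_val.comp f.continuous⟩
    fun h hh => ContinuousMap.ext fun t => (f t).2 ⟨h, hh⟩

theorem ofFixed_one {H : Subgroup G} {n : ℕ}
    (f : C(stdSimplex ℝ (Fin n), MulAction.fixedPoints H X)) (t : stdSimplex ℝ (Fin n)) :
    ofFixed f ((1 : G) : G ⧸ H) t = (f t).1 := by
  rw [ofFixed, MulAction.homOfFixed_apply, one_smul]
  rfl

/-- Equivariant families over `G/H` are determined by the simplex at the trivial coset, which is a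
singular simplex of `X^H`. Coning along a contraction of `X^H` is an extra degeneracy. -/
theorem singBd_exact (H : Subgroup G) [ContractibleSpace (MulAction.fixedPoints H X)] :
    (∀ x : FreeAbelianGroup ((G ⧸ H) →[G] C(stdSimplex ℝ (Fin 0), X)),
      ∃ y, singBd X (G ⧸ H) 0 y = x) ∧
    ∀ (n : ℕ) (x : FreeAbelianGroup ((G ⧸ H) →[G] C(stdSimplex ℝ (Fin (n + 1)), X))),
      singBd X (G ⧸ H) n x = 0 → ∃ y, singBd X (G ⧸ H) (n + 1) y = x := by
  obtain ⟨y₀, ⟨h⟩⟩ := id_nullhomotopic (MulAction.fixedPoints H X)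
  refine exact_of_extra (T := fun n => (G ⧸ H) →[G] C(stdSimplex ℝ (Fin n), X))
    (fun n i s => (singFace G X i).comp s) (fun n F => ofFixed (hat h (toFixed F)))
    (fun n F => ?_) (fun n i F => ?_)
  · refine hom_eq_of_apply_eq ((1 : G) : G ⧸ H) (ContinuousMap.ext fun t => ?_)
    refine (ofFixed_one _ _).trans ?_
    exact congrArg Subtype.val (DFunLike.congr_fun (hat_face_zero h (toFixed F)) t)
  · refine hom_eq_of_apply_eq ((1 : G) : G ⧸ H) (ContinuousMap.ext fun t => ?_)
    refine (ofFixed_one _ _).trans (Eq.trans ?_ (ofFixed_one _ _).symm)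
    exact congrArg Subtype.val (DFunLike.congr_fun (hat_face_succ h (toFixed F) i) t)

end CellCover

/-! ### Free modules over the orbit category on `G`-sets -/

namespace OrbitCat

open FreeAbelianGroup FreeChain CellCover

variable {G : Type u} [Group G]

/-- Makes the naturality statements for surjective `r` available for every morphism of the orbit
category. -/
theorem hom_surjective {L L' : OrbitCat G} (r : (G ⧸ L.subgroup) →[G] (G ⧸ L'.subgroup)) :
    Function.Surjective r := by
  intro q
  obtain ⟨g, hg⟩ := MulAction.exists_smul_eq G (r ((1 : G) : G ⧸ L.subgroup)) q
  exact ⟨g • ((1 : G) : G ⧸ L.subgroup), by rw [map_smul, hg]⟩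

variable (G) in
/-- The module `G/L ↦ ℤ[Map_G(G/L, T)]`. -/
def freeOn (T : Type u) [MulAction G T] : Mod G where
  obj L := AddCommGrpCat.of (FreeAbelianGroup ((G ⧸ L.unop.subgroup) →[G] T))
  map f := AddCommGrpCat.ofHom (map (precomp f.unop))
  map_id _ := AddCommGrpCat.hom_ext (lift_ext _ _ fun x => map_of_apply x)
  map_comp f g := AddCommGrpCat.hom_ext (map_comp (f := precomp f.unop) (g := precomp g.unop))

/-- A natural family of homomorphisms out of a free module. -/
def freeOnHom {T : Type u} [MulAction G T] {M : Mod G}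
    (φ : ∀ L : OrbitCat G, FreeAbelianGroup ((G ⧸ L.subgroup) →[G] T) →+
      M.obj (Opposite.op L))
    (h : ∀ (L L' : OrbitCat G) (r : L' ⟶ L) (s : (G ⧸ L.subgroup) →[G] T),
      φ L' (of (precomp r s)) = (M.map r.op).hom (φ L (of s))) : freeOn G T ⟶ M where
  app L := AddCommGrpCat.ofHom (φ L.unop)
  naturality L L' f := by
    refine AddCommGrpCat.hom_ext (lift_ext _ _ fun s => ?_)
    exact (congrArg (φ L'.unop) (map_of_apply s)).trans (h L.unop L'.unop f.unop s)

/-- The augmentation of a free module. -/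
def aug (T : Type u) [MulAction G T] : freeOn G T ⟶ trivialMod G :=
  freeOnHom (fun _ => lift fun _ => (ULift.up (1 : ℤ) : ULift.{u} ℤ)) fun L L' r s => by
    refine (lift_apply_of _ _).trans ?_
    exact (lift_apply_of (fun _ : (G ⧸ L.subgroup) →[G] T => (ULift.up (1 : ℤ) : ULift.{u} ℤ))
      s).symm

theorem aug_of (T : Type u) [MulAction G T] (L : (OrbitCat G)ᵒᵖ)
    (s : (G ⧸ L.unop.subgroup) →[G] T) :
    ((aug T).app L).hom (of s : FreeAbelianGroup ((G ⧸ L.unop.subgroup) →[G] T)) =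
      (ULift.up (1 : ℤ) : ULift.{u} ℤ) :=
  lift_apply_of _ _

theorem freeOn_hom_ext {T : Type u} [MulAction G T] {M : Mod G} {f g : freeOn G T ⟶ M}
    (h : ∀ (L : (OrbitCat G)ᵒᵖ) (s : (G ⧸ L.unop.subgroup) →[G] T),
      (f.app L).hom (of s : FreeAbelianGroup ((G ⧸ L.unop.subgroup) →[G] T)) =
        (g.app L).hom (of s : FreeAbelianGroup ((G ⧸ L.unop.subgroup) →[G] T))) : f = g := by
  ext L x
  exact DFunLike.congr_fun (lift_ext (f.app L).hom (g.app L).hom (h L)) x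

/-- Exactness in the category of modules is tested objectwise. -/
theorem mod_exact (S : ShortComplex (Mod G))
    (h : ∀ (L : (OrbitCat G)ᵒᵖ) (x : S.X₂.obj L), (S.g.app L).hom x = 0 →
      ∃ y : S.X₁.obj L, (S.f.app L).hom y = x) : S.Exact := by
  rw [ShortComplex.exact_iff_isZero_homology]
  refine Functor.isZero _ fun L => ?_
  have : (S.map ((evaluation _ _).obj L)).Exact := by
    rw [ShortComplex.ab_exact_iff]
    exact h L
  rw [ShortComplex.exact_iff_isZero_homology] at this
  exact this.of_iso (S.mapHomologyIso ((evaluation _ _).obj L)).symm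

theorem mod_epi {M N : Mod G} (f : M ⟶ N)
    (h : ∀ (L : (OrbitCat G)ᵒᵖ) (x : N.obj L), ∃ y : M.obj L, (f.app L).hom y = x) : Epi f := by
  rw [NatTrans.epi_iff_epi_app]
  exact fun L => (AddCommGrpCat.epi_iff_surjective _).2 (h L)

theorem sum_app_hom {M N : Mod G} {J : Type*} (t : Finset J) (f : J → (M ⟶ N))
    (L : (OrbitCat G)ᵒᵖ) (x : M.obj L) :
    ((∑ j ∈ t, f j).app L).hom x = ∑ j ∈ t, ((f j).app L).hom x :=
  map_sum (⟨⟨fun k : M ⟶ N => (k.app L).hom x, rfl⟩, fun _ _ => rfl⟩ : (M ⟶ N) →+ N.obj L) f t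

/-! #### Free modules on `G`-sets with finite stabilizers -/

section Generators

variable {T : Type u} [MulAction G T]

/-- The map `G/K → T` determined by a point with stabilizer `K`. -/
def orbitHom (t : T) : (G ⧸ MulAction.stabilizer G t) →[G] T :=
  MulAction.homOfFixed _ t fun _ h => h

theorem orbitHom_coe (t : T) (g : G) :
    orbitHom t (g : G ⧸ MulAction.stabilizer G t) = g • t := rfl

theorem orbitHom_injective (t : T) : Function.Injective (orbitHom (G := G) t) := by
  intro a b
  induction a using QuotientGroup.induction_on with
  | H a =>
    induction b using QuotientGroup.induction_on with
    | H b =>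
      intro h
      rw [QuotientGroup.eq, MulAction.mem_stabilizer_iff, mul_smul, inv_smul_eq_iff]
      exact Eq.symm h

/-- After moving `q` to the trivial coset, `s` takes there a value `g • t` fixed by `L`. Since
`orbitHom t` is injective, the coset of `g` is fixed by `L` too, and it defines the factorization.
-/
theorem exists_factor (t : T) {L : Subgroup G} (s : (G ⧸ L) →[G] T) (q : G ⧸ L)
    (h : s q ∈ MulAction.orbit G t) :
    ∃ φ : (G ⧸ L) →[G] (G ⧸ MulAction.stabilizer G t), (orbitHom t).comp φ = s := by
  obtain ⟨a, rfl⟩ := MulAction.exists_smul_eq G ((1 : G) : G ⧸ L) q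
  rw [map_smul] at h
  obtain ⟨g, hg⟩ : s ((1 : G) : G ⧸ L) ∈ MulAction.orbit G t := by
    obtain ⟨g, hg⟩ := h
    refine ⟨a⁻¹ * g, ?_⟩
    show (a⁻¹ * g) • t = _
    rw [mul_smul, inv_smul_eq_iff]
    exact hg
  have hfix : ∀ l ∈ L, l • (g : G ⧸ MulAction.stabilizer G t) = g := by
    intro l hl
    have h1 : (l * g) • t = g • t := by
      rw [mul_smul]
      exact (congrArg (l • ·) hg).trans ((MulAction.smul_hom_one s l hl).trans hg.symm)
    exact orbitHom_injective t (((orbitHom_coe t (l * g)).trans h1).trans (orbitHom_coe t g).symm)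
  refine ⟨MulAction.homOfFixed L (g : G ⧸ MulAction.stabilizer G t) hfix, ?_⟩
  refine hom_eq_of_apply_eq ((1 : G) : G ⧸ L) (Eq.trans ?_ hg)
  have h2 : MulAction.homOfFixed L (g : G ⧸ MulAction.stabilizer G t) hfix ((1 : G) : G ⧸ L) = g :=
    (MulAction.homOfFixed_apply L _ hfix 1).trans (one_smul _ _)
  rw [MulActionHom.comp_apply, h2]
  exact orbitHom_coe t g

/-- The inclusion of a free summand. -/
def summandι (t : T) (ht : Finite (MulAction.stabilizer G t)) :
    free (⟨MulAction.stabilizer G t, ht⟩ : OrbitCat G) ⟶ freeOn G T where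
  app L := AddCommGrpCat.ofHom
    (map fun φ : L.unop ⟶ (⟨MulAction.stabilizer G t, ht⟩ : OrbitCat G) => (orbitHom t).comp φ)
  naturality L L' f := by
    refine AddCommGrpCat.hom_ext (lift_ext _ _ fun s => ?_)
    rfl

open Classical in
/-- The factorization of a map `G/L → T` through the orbit of `t`, or zero if there is none. -/
noncomputable def factor (t : T) (L : Subgroup G) (s : (G ⧸ L) →[G] T) :
    FreeAbelianGroup ((G ⧸ L) →[G] (G ⧸ MulAction.stabilizer G t)) :=
  if h : ∃ φ : (G ⧸ L) →[G] (G ⧸ MulAction.stabilizer G t), (orbitHom t).comp φ = s then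
    of h.choose
  else 0

theorem factor_of (t : T) {L : Subgroup G} (φ : (G ⧸ L) →[G] (G ⧸ MulAction.stabilizer G t)) :
    factor t L ((orbitHom t).comp φ) = of φ := by
  have h : ∃ φ', (orbitHom t).comp φ' = (orbitHom t).comp φ := ⟨φ, rfl⟩
  rw [factor, dif_pos h]
  exact congrArg of (MulActionHom.ext fun q => orbitHom_injective t
    (DFunLike.congr_fun h.choose_spec q))

theorem factor_of_not (t : T) {L : Subgroup G} {s : (G ⧸ L) →[G] T} (q : G ⧸ L)
    (h : s q ∉ MulAction.orbit G t) : factor t L s = 0 := by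
  refine dif_neg ?_
  rintro ⟨φ, rfl⟩
  refine h ?_
  rw [MulActionHom.comp_apply]
  generalize φ q = a
  induction a using QuotientGroup.induction_on with
  | H a => exact ⟨a, rfl⟩

theorem factor_precomp (t : T) {L L' : Subgroup G} (r : (G ⧸ L') →[G] (G ⧸ L))
    (s : (G ⧸ L) →[G] T) : factor t L' (precomp r s) = map (precomp r) (factor t L s) := by
  by_cases h : s (r ((1 : G) : G ⧸ L')) ∈ MulAction.orbit G t
  · obtain ⟨φ, rfl⟩ := exists_factor t s _ h
    rw [factor_of, map_of_apply]
    exact factor_of t (φ.comp r)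
  · rw [factor_of_not t _ h, map_zero]
    exact factor_of_not t ((1 : G) : G ⧸ L') h

/-- The projection to a free summand. -/
noncomputable def summandπ (t : T) (ht : Finite (MulAction.stabilizer G t)) :
    freeOn G T ⟶ free (⟨MulAction.stabilizer G t, ht⟩ : OrbitCat G) :=
  freeOnHom (fun L => lift (factor t L.subgroup)) fun L L' r s => by
    refine (lift_apply_of _ _).trans ((factor_precomp t r s).trans ?_)
    exact congrArg (map (precomp r)) (lift_apply_of (factor t L.subgroup) s).symm

theorem summandπ_of (t : T) (ht : Finite (MulAction.stabilizer G t)) (L : (OrbitCat G)ᵒᵖ)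
    (s : (G ⧸ L.unop.subgroup) →[G] T) (h : s ((1 : G) : G ⧸ L.unop.subgroup) ∈
      MulAction.orbit G t) :
    ((summandπ t ht ≫ summandι t ht).app L).hom
      (of s : FreeAbelianGroup ((G ⧸ L.unop.subgroup) →[G] T)) =
      (of s : FreeAbelianGroup ((G ⧸ L.unop.subgroup) →[G] T)) := by
  obtain ⟨φ, rfl⟩ := exists_factor t s _ h
  refine (congrArg ((summandι t ht).app L).hom
    ((lift_apply_of (factor t L.unop.subgroup) _).trans (factor_of t φ))).trans ?_
  exact map_of_apply φ

theorem summandπ_of_not (t : T) (ht : Finite (MulAction.stabilizer G t)) (L : (OrbitCat G)ᵒᵖ)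
    (s : (G ⧸ L.unop.subgroup) →[G] T) (h : s ((1 : G) : G ⧸ L.unop.subgroup) ∉
      MulAction.orbit G t) :
    ((summandπ t ht ≫ summandι t ht).app L).hom
      (of s : FreeAbelianGroup ((G ⧸ L.unop.subgroup) →[G] T)) =
      (0 : FreeAbelianGroup ((G ⧸ L.unop.subgroup) →[G] T)) := by
  refine (congrArg ((summandι t ht).app L).hom
    ((lift_apply_of (factor t L.unop.subgroup) _).trans (factor_of_not t _ h))).trans ?_
  exact map_zero _

/-- A module is a retract of a finite sum of modules `ℤ[-, G/K]`. -/
def IsFinFree (M : Mod G) : Prop :=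
  ∃ (J : Type u) (_ : Fintype J) (K : J → OrbitCat G) (π : ∀ j, M ⟶ free (K j))
    (ι : ∀ j, free (K j) ⟶ M), ∑ j, π j ≫ ι j = 𝟙 M

/-- By transitivity a map `G/L → T` lands in exactly one orbit, so exactly one summand contributes
and returns the map. -/
theorem isFinFree_freeOn [Finite (MulAction.orbitRel.Quotient G T)]
    (h : ∀ t : T, Finite (MulAction.stabilizer G t)) : IsFinFree (freeOn G T) := by
  classical
  have := Fintype.ofFinite (MulAction.orbitRel.Quotient G T)
  refine ⟨MulAction.orbitRel.Quotient G T, this, fun j => ⟨_, h j.out⟩,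
    fun j => summandπ j.out (h _), fun j => summandι j.out (h _), ?_⟩
  refine freeOn_hom_ext fun L s => ?_
  refine (sum_app_hom _ _ _ _).trans ?_
  let j : MulAction.orbitRel.Quotient G T :=
    Quotient.mk'' (s ((1 : G) : G ⧸ L.unop.subgroup))
  have hmem : ∀ j' : MulAction.orbitRel.Quotient G T,
      s ((1 : G) : G ⧸ L.unop.subgroup) ∈ MulAction.orbit G j'.out ↔ j = j' := by
    intro j'
    rw [← MulAction.orbitRel_apply]
    conv_rhs => rw [← Quotient.out_eq' j']
    exact Quotient.eq''.symm
  refine (Finset.sum_eq_single j (fun j' _ hj => ?_) (by simp)).trans ?_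
  · exact summandπ_of_not _ _ L s (mt (hmem j').1 (Ne.symm hj))
  · exact summandπ_of _ _ L s ((hmem j).2 rfl)

theorem IsFinFree.projective {M : Mod G} (h : IsFinFree M) : Projective M := by
  obtain ⟨J, _, K, π, ι, hid⟩ := h
  refine ⟨fun {E N} f e _ => ⟨∑ j, π j ≫ Projective.factorThru (ι j ≫ f) e, ?_⟩⟩
  rw [Preadditive.sum_comp]
  simp only [Category.assoc, Projective.factorThru_comp]
  simp only [← Category.assoc]
  rw [← Preadditive.sum_comp, hid, Category.id_comp]

end Generators

end OrbitCat

/-! ### Vanishing of the cohomology of `Hom(P, M)` -/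

namespace ChainComplex

open Limits

variable {C : Type*} [Category* C] [Abelian C]

/-- Every `n`-cocycle of `Hom(P, M)` is a coboundary. -/
def CohomologyVanishes (P : ChainComplex C ℕ) (n : ℕ) (M : C) : Prop :=
  ∀ w : P.X n ⟶ M, P.d (n + 1) n ≫ w = 0 →
    ∃ t : P.X ((ComplexShape.down ℕ).next n) ⟶ M, P.d n ((ComplexShape.down ℕ).next n) ≫ t = w

variable {P : ChainComplex C ℕ}

theorem cohomologyVanishes_succ_iff (n : ℕ) (M : C) : CohomologyVanishes P (n + 1) M ↔
    ∀ w : P.X (n + 1) ⟶ M, P.d (n + 2) (n + 1) ≫ w = 0 → ∃ t : P.X n ⟶ M,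
      P.d (n + 1) n ≫ t = w := by
  unfold CohomologyVanishes
  rw [show (ComplexShape.down ℕ).next (n + 1) = n from ChainComplex.next_nat_succ n]

theorem CohomologyVanishes.of_factor {n : ℕ} {M N : C} {w : P.X n ⟶ N} (f : M ⟶ N)
    (h : CohomologyVanishes P n M) (x : P.X n ⟶ M) (hx : P.d (n + 1) n ≫ x = 0)
    (hw : x ≫ f = w) :
    ∃ t : P.X ((ComplexShape.down ℕ).next n) ⟶ N,
      P.d n ((ComplexShape.down ℕ).next n) ≫ t = w := by
  obtain ⟨t, ht⟩ := h x hx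
  exact ⟨t ≫ f, by rw [← Category.assoc, ht, hw]⟩

/-- A cocycle changes by a coboundary under a self-map homotopic to the identity. -/
theorem exists_coboundary {D : ChainComplex C ℕ} {φ : P ⟶ D} {ψ : D ⟶ P}
    (h : Homotopy (φ ≫ ψ) (𝟙 P)) {n : ℕ} {M : C} (w : P.X n ⟶ M) (hw : P.d (n + 1) n ≫ w = 0) :
    ∃ t : P.X ((ComplexShape.down ℕ).next n) ⟶ M,
      φ.f n ≫ ψ.f n ≫ w = w + P.d n ((ComplexShape.down ℕ).next n) ≫ t := by
  refine ⟨h.hom _ n ≫ w, ?_⟩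
  have h1 := h.comm n
  rw [prevD_eq h.hom (show (ComplexShape.down ℕ).Rel (n + 1) n from rfl)] at h1
  have h2 := congrArg (· ≫ w) h1
  simp only [HomologicalComplex.comp_f, Preadditive.add_comp, Category.assoc, hw, comp_zero,
    add_zero, HomologicalComplex.id_f, Category.id_comp] at h2
  rw [h2, add_comm]
  congr 1
  exact Category.assoc _ _ _

/-- A cocycle on `P` agrees up to coboundary with the pullback along `φ` of a cocycle on `D`, which
is a coboundary. -/
theorem CohomologyVanishes.of_homotopy {D : ChainComplex C ℕ} {φ : P ⟶ D} {ψ : D ⟶ P}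
    (h : Homotopy (φ ≫ ψ) (𝟙 P)) {n : ℕ} {M : C} (hD : CohomologyVanishes D n M) :
    CohomologyVanishes P n M := by
  intro w hw
  obtain ⟨t, ht⟩ := exists_coboundary h w hw
  obtain ⟨s, hs⟩ := hD (ψ.f n ≫ w) (by
    rw [← Category.assoc, ← ψ.comm, Category.assoc, hw, comp_zero])
  refine ⟨φ.f _ ≫ s - t, ?_⟩
  rw [Preadditive.comp_sub, ← Category.assoc, ← φ.comm, Category.assoc, hs, ht,
    add_sub_cancel_right]

theorem cohomologyVanishes_of_isZero {n : ℕ} (h : IsZero (P.X n)) (M : C) :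
    CohomologyVanishes P n M :=
  fun _ _ => ⟨0, h.eq_of_src _ _⟩

/-- Right exactness of the top cohomology. -/
theorem CohomologyVanishes.of_epi {n : ℕ} {M N : C} (e : M ⟶ N) [Epi e] [Projective (P.X n)]
    (hM : CohomologyVanishes P n M) (hK : CohomologyVanishes P (n + 1) (kernel e)) :
    CohomologyVanishes P n N := by
  intro w hw
  -- Lift `w` along `e`. The coboundary of the lift is a cocycle with values in the kernel, hence
  -- the coboundary of some `t`; subtracting `t` makes the lift a cocycle.
  have h1 : P.d (n + 1) n ≫ Projective.factorThru w e ≫ e = 0 := by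
    rw [Projective.factorThru_comp, hw]
  obtain ⟨t, ht⟩ := (cohomologyVanishes_succ_iff n _).1 hK
    (kernel.lift e (P.d (n + 1) n ≫ Projective.factorThru w e) (by rw [Category.assoc, h1])) (by
      rw [← cancel_mono (kernel.ι e), Category.assoc, kernel.lift_ι, ← Category.assoc, P.d_comp_d,
        zero_comp, zero_comp])
  refine hM.of_factor e (Projective.factorThru w e - t ≫ kernel.ι e) ?_ ?_
  · rw [Preadditive.comp_sub, ← Category.assoc, ht, kernel.lift_ι, sub_self]
  · rw [Preadditive.sub_comp, Category.assoc, kernel.condition, comp_zero, sub_zero,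
      Projective.factorThru_comp]

/-- Half exactness of cohomology. -/
theorem CohomologyVanishes.of_shortExact {n : ℕ} {S : ShortComplex C} (hS : S.ShortExact)
    [∀ i, Projective (P.X i)] (h₁ : CohomologyVanishes P n S.X₁)
    (h₃ : CohomologyVanishes P n S.X₃) : CohomologyVanishes P n S.X₂ := by
  intro w hw
  have := hS.epi_g
  have := hS.mono_f
  obtain ⟨t, ht⟩ := h₃ (w ≫ S.g) (by rw [← Category.assoc, hw, zero_comp])
  -- Removing a coboundary makes the image in `S.X₃` zero, so `y` is a cocycle with values in
  -- `S.X₁`.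
  let y := w - P.d n _ ≫ Projective.factorThru t S.g
  have hy : y ≫ S.g = 0 := by
    simp only [y, Preadditive.sub_comp, Category.assoc, Projective.factorThru_comp, ht, sub_self]
  obtain ⟨s, hs⟩ := h₁.of_factor (w := y) S.f (hS.exact.lift y hy) (by
    rw [← cancel_mono S.f, Category.assoc, hS.exact.lift_f, zero_comp, Preadditive.comp_sub, hw,
      ← Category.assoc, P.d_comp_d, zero_comp, sub_zero]) (hS.exact.lift_f y hy)
  exact ⟨s + Projective.factorThru t S.g, by rw [Preadditive.comp_add, hs, sub_add_cancel]⟩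

/-- Cohomology vanishes on retracts of finite sums. -/
theorem CohomologyVanishes.of_sum {n : ℕ} {M : C} {J : Type*} [Fintype J] {K : J → C}
    (π : ∀ j, M ⟶ K j) (ι : ∀ j, K j ⟶ M) (h : ∑ j, π j ≫ ι j = 𝟙 M)
    (hK : ∀ j, CohomologyVanishes P n (K j)) : CohomologyVanishes P n M := by
  intro w hw
  choose t ht using fun j => hK j (w ≫ π j) (by rw [← Category.assoc, hw, zero_comp])
  refine ⟨∑ j, t j ≫ ι j, ?_⟩
  rw [Preadditive.comp_sum]
  simp only [← Category.assoc, ht]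
  simp only [Category.assoc]
  rw [← Preadditive.comp_sum, h, Category.comp_id]

/-- If the identity of `P` factors through `D` up to homotopy, vanishing of the top cohomology
is detected by the terms of `D`. -/
theorem CohomologyVanishes.of_terms {D : ChainComplex C ℕ} {φ : P ⟶ D} {ψ : D ⟶ P}
    (h : Homotopy (φ ≫ ψ) (𝟙 P)) [∀ i, Projective (P.X i)] {n : ℕ}
    (hD : CohomologyVanishes P n (D.X n)) (h' : ∀ M, CohomologyVanishes P (n + 1) M) (M : C) :
    CohomologyVanishes P n M := by
  intro w hw
  obtain ⟨t, ht⟩ := exists_coboundary h w hw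
  -- This image is a quotient of `D.X n`, so right exactness applies. The cocycle `φ ≫ ψ ≫ w`
  -- factors through it and differs from `w` by a coboundary.
  have h1 : CohomologyVanishes P n (image (ψ.f n ≫ w)) :=
    hD.of_epi (factorThruImage (ψ.f n ≫ w)) (h' _)
  obtain ⟨s, hs⟩ := h1.of_factor (image.ι (ψ.f n ≫ w)) (φ.f n ≫ factorThruImage (ψ.f n ≫ w)) (by
    rw [← cancel_mono (image.ι (ψ.f n ≫ w)), Category.assoc, Category.assoc, image.fac, zero_comp,
      ← φ.comm_assoc, ← ψ.comm_assoc, hw, comp_zero, comp_zero])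
    (by rw [Category.assoc, image.fac])
  exact ⟨s - t, by rw [Preadditive.comp_sub, hs, ht, add_sub_cancel_right]⟩

/-- Lifting a map of augmentations to a chain map. -/
theorem exists_lift {B : ChainComplex C ℕ} {Z : C} [∀ i, Projective (P.X i)] (p : P.X 0 ⟶ Z)
    (hp : P.d 1 0 ≫ p = 0) (e : B.X 0 ⟶ Z) [Epi e] (he : B.d 1 0 ≫ e = 0)
    (h0 : (ShortComplex.mk _ _ he).Exact)
    (h1 : ∀ n, (ShortComplex.mk _ _ (B.d_comp_d (n + 2) (n + 1) n)).Exact) :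
    ∃ φ : P ⟶ B, φ.f 0 ≫ e = p := by
  have hz : (P.d 1 0 ≫ Projective.factorThru p e) ≫ e = 0 := by
    rw [Category.assoc, Projective.factorThru_comp, hp]
  refine ⟨ChainComplex.mkHom P B (Projective.factorThru p e)
    (h0.liftFromProjective (P.d 1 0 ≫ Projective.factorThru p e) hz)
    (h0.liftFromProjective_comp _ hz) (fun n q => ?_), ?_⟩
  · have hq : (P.d (n + 2) (n + 1) ≫ q.2.1) ≫ B.d (n + 1) n = 0 := by
      rw [Category.assoc, q.2.2, ← Category.assoc, P.d_comp_d, zero_comp]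
    exact ⟨(h1 n).liftFromProjective _ hq, (h1 n).liftFromProjective_comp _ hq⟩
  · exact Projective.factorThru_comp p e

theorem nontrivial_homology_linearYonedaObj_iff (n : ℕ) (M : C) :
    Nontrivial ((P.linearYonedaObj ℤ M).homology n) ↔ ¬ CohomologyVanishes P n M := by
  rw [← not_subsingleton_iff_nontrivial, not_iff_not, ← ModuleCat.isZero_iff_subsingleton,
    ← HomologicalComplex.exactAt_iff_isZero_homology,
    HomologicalComplex.exactAt_iff' _ ((ComplexShape.down ℕ).next n) n (n + 1) (by
      cases n <;> simp) (by simp), ShortComplex.moduleCat_exact_iff]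
  rfl

end ChainComplex

/-! ### Resolutions of minimal length -/

namespace CategoryTheory.ProjectiveResolution

open Limits ChainComplex

variable {C : Type*} [Category* C] [Abelian C] 

/-- The cokernel of a boundary is projective if the boundary is a retract. -/
theorem projective_of_retraction {S : ShortComplex C} (hS : S.Exact) [Epi S.g] [Projective S.X₂]
    (r : S.X₂ ⟶ image S.f) (hr : S.f ≫ r = factorThruImage S.f) : Projective S.X₃ := by
  have h0 : image.ι S.f ≫ S.g = 0 := by
    rw [← cancel_epi (factorThruImage S.f), ← Category.assoc, image.fac, S.zero, comp_zero]
  -- The endomorphism `1 - r ≫ ι` kills `S.f`, so it descends to a section of `S.g`.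
  have hk : S.f ≫ (𝟙 S.X₂ - r ≫ image.ι S.f) = 0 := by
    rw [Preadditive.comp_sub, Category.comp_id, ← Category.assoc, hr, image.fac, sub_self]
  refine Retract.projective (Y := S.X₂) ⟨hS.desc _ hk, S.g, ?_⟩
  rw [← cancel_epi S.g, ← Category.assoc, hS.g_desc, Preadditive.sub_comp, Category.assoc, h0,
    comp_zero, sub_zero, Category.id_comp, Category.comp_id]

theorem exact_of_epi_lift {S : ShortComplex C} (e : S.X₁ ⟶ kernel S.g) [Epi e]
    (h : e ≫ kernel.ι S.g = S.f) : S.Exact := by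
  rw [S.exact_iff_epi_kernel_lift]
  have : kernel.lift S.g S.f S.zero = e := by
    rw [← cancel_mono (kernel.ι S.g), kernel.lift_ι, h]
  rw [this]
  infer_instance

theorem exact_of_comp_mono {X Y Z W : C} {f : X ⟶ Y} {g : Y ⟶ Z} (m : Z ⟶ W) [Mono m]
    {h : Y ⟶ W} (hg : g ≫ m = h) (w : f ≫ h = 0) (hex : (ShortComplex.mk f h w).Exact)
    (w' : f ≫ g = 0) : (ShortComplex.mk f g w').Exact := by
  let φ : ShortComplex.mk f g w' ⟶ ShortComplex.mk f h w :=
    { τ₁ := 𝟙 _, τ₂ := 𝟙 _, τ₃ := m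
      comm₁₂ := by simp
      comm₂₃ := by simp [hg] }
  have : Epi φ.τ₁ := inferInstanceAs (Epi (𝟙 X))
  have : IsIso φ.τ₂ := inferInstanceAs (IsIso (𝟙 Y))
  have : Mono φ.τ₃ := inferInstanceAs (Mono m)
  exact (ShortComplex.exact_iff_of_epi_of_isIso_of_mono φ).2 hex

/-- The corestriction of the boundary to its image is a cocycle; a primitive of it is the required
map. -/
theorem exists_retraction {P : ChainComplex C ℕ} {n : ℕ}
    (h : CohomologyVanishes P (n + 1) (image (P.d (n + 1) n))) :
    ∃ r : P.X n ⟶ image (P.d (n + 1) n), P.d (n + 1) n ≫ r = factorThruImage (P.d (n + 1) n) := by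
  refine (cohomologyVanishes_succ_iff n _).1 h _ ?_
  rw [← cancel_mono (image.ι _), Category.assoc, image.fac, P.d_comp_d, zero_comp]

/-! ### A projective resolution that ends once a syzygy is projective. -/

variable [EnoughProjectives C]

/-- Taking the identity when `M` is projective is what lets the resolution stop; an arbitrary
projective cover of a projective syzygy could have a non-zero kernel. -/
theorem exists_cover {C : Type*} [Category* C] [EnoughProjectives C] (M : C) :
    ∃ (p : C) (f : p ⟶ M), Projective p ∧ Epi f ∧ (Projective M → IsIso f) := by
  by_cases h : Projective M
  · exact ⟨M, 𝟙 M, h, inferInstance, fun _ => inferInstance⟩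
  · exact ⟨Projective.over M, Projective.π M, inferInstance, inferInstance, fun h' => absurd h' h⟩

/-- A projective object covering `M`, isomorphic to `M` if `M` is projective. -/
noncomputable def cover (M : C) : C := (exists_cover M).choose

/-- The projection from the projective cover. -/
noncomputable def coverπ (M : C) : cover M ⟶ M := (exists_cover M).choose_spec.choose

instance (M : C) : Projective (cover M) := (exists_cover M).choose_spec.choose_spec.1

instance (M : C) : Epi (coverπ M) := (exists_cover M).choose_spec.choose_spec.2.1

omit [Abelian C] in
theorem isIso_coverπ (M : C) (h : Projective M) : IsIso (coverπ M) :=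
  (exists_cover M).choose_spec.choose_spec.2.2 h

/-- The next differential. -/
noncomputable def nextD {M N : C} (f : M ⟶ N) : cover (kernel f) ⟶ M :=
  coverπ (kernel f) ≫ kernel.ι f

theorem nextD_comp {M N : C} (f : M ⟶ N) : nextD f ≫ f = 0 := by
  rw [nextD, Category.assoc, kernel.condition, comp_zero]

/-- The complex of a resolution that stops as soon as possible. -/
noncomputable def minComplex (Z : C) : ChainComplex C ℕ :=
  ChainComplex.mk' (cover Z) (cover (kernel (coverπ Z))) (nextD (coverπ Z))
    fun f => ⟨_, nextD f, nextD_comp f⟩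

/-- The augmentation. -/
noncomputable def minComplexπ (Z : C) : (minComplex Z).X 0 ⟶ Z := coverπ Z

theorem minComplex_d_one (Z : C) : (minComplex Z).d 1 0 = nextD (coverπ Z) :=
  ChainComplex.mk'_d_1_0 _ _ _ _

/-- The map onto the kernel of the augmentation. -/
noncomputable def minComplexOne (Z : C) : (minComplex Z).X 1 ⟶ kernel (minComplexπ Z) :=
  coverπ (kernel (coverπ Z))

instance (Z : C) : Epi (minComplexOne Z) := inferInstanceAs (Epi (coverπ (kernel (coverπ Z))))

theorem isIso_minComplexOne (Z : C) (h : Projective (kernel (minComplexπ Z))) :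
    IsIso (minComplexOne Z) :=
  isIso_coverπ _ h

theorem minComplexOne_ι (Z : C) :
    minComplexOne Z ≫ kernel.ι (minComplexπ Z) = (minComplex Z).d 1 0 :=
  (minComplex_d_one Z).symm

theorem minComplex_d_π (Z : C) : (minComplex Z).d 1 0 ≫ minComplexπ Z = 0 := by
  rw [minComplex_d_one]
  exact nextD_comp (coverπ Z)

/-- The recursive description of the terms. -/
noncomputable def minComplexIso (Z : C) (n : ℕ) :
    (minComplex Z).X (n + 2) ≅ cover (kernel ((minComplex Z).d (n + 1) n)) :=
  ChainComplex.mk'XIso _ _ _ _ n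

theorem minComplex_d (Z : C) (n : ℕ) : (minComplex Z).d (n + 2) (n + 1) =
    (minComplexIso Z n).hom ≫ nextD ((minComplex Z).d (n + 1) n) :=
  ChainComplex.mk'_d _ _ _ (fun f => ⟨_, nextD f, nextD_comp f⟩) n

theorem minComplex_exact_zero (Z : C) :
    (ShortComplex.mk _ _ (minComplex_d_π Z)).Exact :=
  exact_of_epi_lift (S := ShortComplex.mk _ _ (minComplex_d_π Z)) (minComplexOne Z)
    (minComplexOne_ι Z)

theorem minComplex_exact_succ (Z : C) (n : ℕ) :
    (ShortComplex.mk _ _ ((minComplex Z).d_comp_d (n + 2) (n + 1) n)).Exact :=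
  exact_of_epi_lift (S := ShortComplex.mk _ _ ((minComplex Z).d_comp_d (n + 2) (n + 1) n))
    ((minComplexIso Z n).hom ≫ coverπ (kernel ((minComplex Z).d (n + 1) n)))
    ((Category.assoc _ _ _).trans (minComplex_d Z n).symm)

instance (Z : C) (n : ℕ) : Projective ((minComplex Z).X n) := by
  match n with
  | 0 => exact inferInstanceAs (Projective (cover Z))
  | 1 => exact inferInstanceAs (Projective (cover (kernel (coverπ Z))))
  | n + 2 => exact Projective.of_iso (minComplexIso Z n).symm inferInstance

/-- A projective resolution that stops as soon as possible. -/
noncomputable def min (Z : C) : ProjectiveResolution Z where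
  complex := minComplex Z
  π := (ChainComplex.toSingle₀Equiv _ _).symm ⟨minComplexπ Z,
    minComplex_d_π Z⟩
  quasiIso := ⟨fun n => by
    cases n
    · rw [ChainComplex.quasiIsoAt₀_iff, ShortComplex.quasiIso_iff_of_zeros']
      · refine (ShortComplex.exact_and_epi_g_iff_of_iso ?_).2
          ⟨minComplex_exact_zero Z,
            inferInstanceAs (Epi (coverπ Z))⟩
        exact ShortComplex.isoMk (Iso.refl _) (Iso.refl _) (Iso.refl _)
          (by simp; exact (Category.id_comp _).trans (Category.comp_id ((minComplex Z).d 1 0)).symm)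
          (by simp; exact (Category.id_comp _).trans (Category.comp_id (minComplexπ Z)).symm)
      all_goals rfl
    · rename_i n
      rw [quasiIsoAt_iff_exactAt']
      · rw [HomologicalComplex.exactAt_iff' _ (n + 1 + 1) (n + 1) n (by simp) (by simp)]
        exact minComplex_exact_succ Z n
      · apply ChainComplex.exactAt_succ_single_obj⟩

theorem isZero_minComplex_succ (Z : C) (n : ℕ) (h : IsZero ((minComplex Z).X (n + 1))) :
    ∀ i, n < i → IsZero ((minComplex Z).X i) := by
  intro i hi
  induction i, hi using Nat.le_induction with
  | base => exact h
  | succ i hi ih =>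
    obtain ⟨i, rfl⟩ : ∃ j, i = j + 1 := ⟨i - 1, by omega⟩
    have h1 : IsZero (kernel ((minComplex Z).d (i + 1) i)) :=
      IsZero.of_mono (kernel.ι _) ih
    have := isIso_coverπ _ h1.projective
    exact h1.of_iso ((minComplexIso Z i) ≪≫ asIso (coverπ _))

theorem isZero_of_mono_d (Z : C) (n : ℕ) (h : Mono ((minComplex Z).d (n + 1) n)) :
    IsZero ((minComplex Z).X (n + 2)) := by
  have h1 : IsZero (kernel ((minComplex Z).d (n + 1) n)) := isZero_kernel_of_mono _
  have := isIso_coverπ _ h1.projective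
  exact h1.of_iso ((minComplexIso Z n) ≪≫ asIso (coverπ _))

/-- If the cohomology vanishes in degree `n + 1`, there is a resolution of length `n`. -/
theorem isZero_min (Z : C) (n : ℕ) (h : ∀ M, CohomologyVanishes (minComplex Z) (n + 1) M) :
    ∀ i, n < i → IsZero ((min Z).complex.X i) := by
  refine isZero_minComplex_succ Z n ?_
  -- The image of the boundary out of degree `n + 1` is a retract, so the `n`-th syzygy is
  -- projective. Its cover is then an isomorphism and the next term is zero. Degrees 0 and 1 are
  -- separate because their syzygies are `Z` and the kernel of the augmentation.
  obtain ⟨r, hr⟩ := exists_retraction (h _)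
  match n with
  | 0 =>
    have : Epi (ShortComplex.mk _ _ (minComplex_d_π Z)).g := inferInstanceAs (Epi (coverπ Z))
    have hZ : Projective Z := projective_of_retraction (minComplex_exact_zero Z) r hr
    have : IsIso (minComplexπ Z) := isIso_coverπ Z hZ
    have h1 : IsZero (kernel (minComplexπ Z)) := isZero_kernel_of_mono _
    have := isIso_minComplexOne Z h1.projective
    exact h1.of_iso (asIso (minComplexOne Z))
  | 1 =>
    have h0 : (minComplex Z).d 2 1 ≫ minComplexOne Z = 0 := by
      rw [← cancel_mono (kernel.ι (minComplexπ Z)), Category.assoc, minComplexOne_ι, zero_comp]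
      exact (minComplex Z).d_comp_d 2 1 0
    have hex := exact_of_comp_mono _ (minComplexOne_ι Z) _ (minComplex_exact_succ Z 0) h0
    have : Epi (ShortComplex.mk _ _ h0).g := inferInstanceAs (Epi (minComplexOne Z))
    have hZ : Projective (kernel (minComplexπ Z)) := projective_of_retraction hex r hr
    have := isIso_minComplexOne Z hZ
    refine isZero_of_mono_d Z 0 ?_
    rw [← minComplexOne_ι]
    exact mono_comp _ _
  | n + 2 =>
    let e : (minComplex Z).X (n + 2) ⟶ kernel ((minComplex Z).d (n + 1) n) :=
      (minComplexIso Z n).hom ≫ coverπ (kernel ((minComplex Z).d (n + 1) n))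
    have he : e ≫ kernel.ι ((minComplex Z).d (n + 1) n) = (minComplex Z).d (n + 2) (n + 1) :=
      (Category.assoc _ _ _).trans (minComplex_d Z n).symm
    have h0 : (minComplex Z).d (n + 3) (n + 2) ≫ e = 0 := by
      rw [← cancel_mono (kernel.ι ((minComplex Z).d (n + 1) n)), Category.assoc, he, zero_comp]
      exact (minComplex Z).d_comp_d (n + 3) (n + 2) (n + 1)
    have hex := exact_of_comp_mono _ he _ (minComplex_exact_succ Z (n + 1)) h0
    have : Epi (ShortComplex.mk _ _ h0).g := inferInstanceAs (Epi (_ ≫ coverπ _))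
    have hZ : Projective (kernel ((minComplex Z).d (n + 1) n)) := projective_of_retraction hex r hr
    have := isIso_coverπ _ hZ
    have : IsIso e := inferInstanceAs (IsIso (_ ≫ coverπ _))
    refine isZero_of_mono_d Z (n + 1) ?_
    rw [← he]
    exact mono_comp _ _

end CategoryTheory.ProjectiveResolution

/-! ### Comparison of the standard resolution with the complex of chains of cell sets -/

namespace OrbitCat

open FreeAbelianGroup FreeChain CellCover Limits

variable {G : Type u} [Group G]

/-! ### Complexes of free modules on augmented semisimplicial `G`-sets. -/

section FaceComplex

variable (T : ℕ → Type u) [∀ n, MulAction G (T n)] (d : ∀ n, Fin (n + 1) → (T (n + 1) →[G] T n))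

/-- The alternating sum of the face maps. -/
def faceHom (n : ℕ) : freeOn G (T (n + 1)) ⟶ freeOn G (T n) :=
  freeOnHom (fun _ => bd fun i s => (d n i).comp s) fun L L' r s => by
    refine (bd_of _ _).trans (Eq.trans ?_ (congrArg (map (precomp r))
      (bd_of (fun i (s : (G ⧸ L.subgroup) →[G] T (n + 1)) => (d n i).comp s) s)).symm)
    rw [map_sum]
    refine Finset.sum_congr rfl fun i _ => ?_
    rw [map_zsmul, map_of_apply]
    rfl

/-- The simplicial identities. -/
def FaceRel : Prop := ∀ (n : ℕ) (i j : Fin (n + 1)) (t : T (n + 2)), i ≤ j →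
  d n i (d (n + 1) j.succ t) = d n j (d (n + 1) i.castSucc t)

variable {T d}

theorem faceHom_faceHom (h : FaceRel T d) (n : ℕ) :
    faceHom T d (n + 1) ≫ faceHom T d n = 0 := by
  refine freeOn_hom_ext fun L s => ?_
  exact bd_bd (fun i s => (d (n + 1) i).comp s)
    (fun i (s : (G ⧸ L.unop.subgroup) →[G] T (n + 1)) => (d n i).comp s)
    (fun i j r hij => MulActionHom.ext fun q => h n i j (r q) hij) (of s)

variable (h : FaceRel T d)

/-- The complex of free modules on an augmented semisimplicial `G`-set. -/
noncomputable def faceComplex : ChainComplex (Mod G) ℕ :=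
  ChainComplex.of (fun n => freeOn G (T (n + 1))) (fun n => faceHom T d (n + 1))
    fun n => faceHom_faceHom h (n + 1)

theorem faceComplex_d (n : ℕ) : (faceComplex h).d (n + 1) n = faceHom T d (n + 1) :=
  ChainComplex.of_d (fun n => freeOn G (T (n + 1))) (fun n => faceHom T d (n + 1)) n

/-- The augmentation of the complex. -/
noncomputable def faceAug : (faceComplex h).X 0 ⟶ trivialMod G := faceHom T d 0 ≫ aug (T 0)

theorem faceComplex_d_aug : (faceComplex h).d 1 0 ≫ faceAug h = 0 := by
  rw [faceComplex_d, faceAug]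
  exact (Category.assoc _ _ _).symm.trans
    ((congrArg (· ≫ aug (T 0)) (faceHom_faceHom h 0)).trans zero_comp)

theorem aug_bijective (T : Type u) [MulAction G T] [Subsingleton T] [Nonempty T]
    (L : (OrbitCat G)ᵒᵖ) : Function.Bijective ((aug T).app L).hom := by
  obtain ⟨t⟩ := ‹Nonempty T›
  let s : (G ⧸ L.unop.subgroup) →[G] T := ⟨fun _ => t, fun _ _ => Subsingleton.elim _ _⟩
  refine Function.bijective_iff_has_inverse.2 ⟨fun y => (y : ULift.{u} ℤ).down •
    (of s : FreeAbelianGroup ((G ⧸ L.unop.subgroup) →[G] T)), fun x => ?_, fun y => ?_⟩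
  · refine DFunLike.congr_fun (f := ((zmultiplesHom _ (of s)).comp
      (AddEquiv.ulift.toAddMonoidHom.comp ((aug T).app L).hom))) (g := AddMonoidHom.id _)
      (lift_ext _ _ fun s' => ?_) x
    have : s' = s := MulActionHom.ext fun _ => Subsingleton.elim _ _
    rw [this]
    refine (congrArg (fun z : ULift.{u} ℤ => z.down • of s) (aug_of T L s)).trans ?_
    exact one_zsmul _
  · refine (map_zsmul ((aug T).app L).hom _ _).trans ?_
    refine (congrArg ((y : ULift.{u} ℤ).down • ·) (aug_of T L s)).trans ?_
    refine ULift.ext _ _ ?_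
    exact (smul_eq_mul _ _).trans (mul_one _)

/-- Exactness of the complex together with its augmentation. -/
theorem faceComplex_exact [Subsingleton (T 0)] [Nonempty (T 0)]
    (hex : ∀ L : OrbitCat G, (∀ x : FreeAbelianGroup ((G ⧸ L.subgroup) →[G] T 0),
        ∃ y, bd (fun i (s : (G ⧸ L.subgroup) →[G] T 1) => (d 0 i).comp s) y = x) ∧
      ∀ (n : ℕ) (x : FreeAbelianGroup ((G ⧸ L.subgroup) →[G] T (n + 1))),
        bd (fun i s => (d n i).comp s) x = 0 →
          ∃ y, bd (fun i (s : (G ⧸ L.subgroup) →[G] T (n + 2)) => (d (n + 1) i).comp s) y = x) :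
    Epi (faceAug h) ∧ (ShortComplex.mk _ _ (faceComplex_d_aug h)).Exact ∧
      ∀ n, (ShortComplex.mk _ _ ((faceComplex h).d_comp_d (n + 2) (n + 1) n)).Exact := by
  refine ⟨mod_epi _ fun L y => ?_, mod_exact _ fun L x hx => ?_, fun n =>
    mod_exact _ fun L x hx => ?_⟩
  -- Since `T 0` is a point, `aug (T 0)` is an isomorphism, and exactness of the sequence ending in
  -- `T 0` becomes exactness with the augmentation.
  · obtain ⟨x, hx⟩ := (aug_bijective (T 0) L).2 y
    obtain ⟨z, hz⟩ := (hex L.unop).1 x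
    exact ⟨z, (congrArg ((aug (T 0)).app L).hom hz).trans hx⟩
  · obtain ⟨y, hy⟩ := (hex L.unop).2 0 x ((aug_bijective (T 0) L).1 (Eq.trans hx (map_zero _).symm))
    refine ⟨y, ?_⟩
    refine Eq.trans ?_ hy
    show (((faceComplex h).d 1 0).app L).hom y = _
    rw [faceComplex_d]
    rfl
  · have hx' : (((faceComplex h).d (n + 1) n).app L).hom x = 0 := hx
    rw [faceComplex_d] at hx'
    obtain ⟨y, hy⟩ := (hex L.unop).2 (n + 1) x hx'
    refine ⟨y, ?_⟩
    refine Eq.trans ?_ hy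
    show (((faceComplex h).d (n + 2) (n + 1)).app L).hom y = _
    rw [faceComplex_d]
    rfl

end FaceComplex

/-! ### The comparison map on modules and the factorization of the identity. -/

variable {X S : Type u} [TopologicalSpace X] [MulAction G X] [ContinuousConstSMul G X]
  [MulAction G S]

variable (G X) in
theorem singFace_rel : FaceRel (fun n => C(stdSimplex ℝ (Fin n), X))
    (fun _ i => singFace G X i) :=
  fun _ i j f hij => singFace_singFace i j hij f

omit [ContinuousConstSMul G X] in
theorem chainFace_rel (c : CellCover G X S) : FaceRel c.Chain (fun _ i => c.chainFace i) :=
  fun _ i j t hij => Subtype.ext (face_face i j t.1 hij)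

/-- The comparison map from singular simplices to chains of cell sets, in one degree. -/
noncomputable def toChainHom (c : CellCover G X S) (n : ℕ) :
    freeOn G C(stdSimplex ℝ (Fin n), X) ⟶ freeOn G (c.Chain n) :=
  freeOnHom (fun _ => c.toChain _ n) fun L L' r s => by
    refine Eq.trans ?_ (c.toChain_map r (hom_surjective r) n (of s))
    rw [map_of_apply]
    rfl

theorem toChainHom_faceHom (c : CellCover G X S) (n : ℕ) :
    toChainHom c (n + 1) ≫ faceHom c.Chain (fun _ i => c.chainFace i) n =
      faceHom (fun n => C(stdSimplex ℝ (Fin n), X)) (fun _ i => singFace G X i) n ≫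
        toChainHom c n := by
  refine freeOn_hom_ext fun L s => ?_
  exact (c.toChain_singBd (Ω := G ⧸ L.unop.subgroup) (of s)).symm

theorem toChainHom_aug (c : CellCover G X S) : toChainHom c 0 ≫ aug _ = aug _ := by
  refine freeOn_hom_ext fun L s => ?_
  have : c.toChain (G ⧸ L.unop.subgroup) 0 (of s) = of (c.mkChain (fun i => i.elim0)
      fun ω => ⟨fun i => i.elim0, fun i => i.elim0⟩) := by
    rw [toChain, AddMonoidHom.comp_apply, AddMonoidHom.comp_apply, subdivide, map_of_apply,
      coneMap, map_of_apply, pr_of]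
  refine (congrArg ((aug (c.Chain 0)).app L).hom this).trans ?_
  rw [aug_of]
  exact (aug_of _ L _).symm

/-- The comparison map. -/
noncomputable def toChainMap (c : CellCover G X S) :
    faceComplex (singFace_rel G X) ⟶ faceComplex (chainFace_rel c) where
  f n := toChainHom c (n + 1)
  comm' i j := by
    rintro rfl
    rw [faceComplex_d, faceComplex_d]
    exact toChainHom_faceHom c (j + 1)

theorem toChainMap_aug (c : CellCover G X S) :
    (toChainMap c).f 0 ≫ faceAug (chainFace_rel c) = faceAug (singFace_rel G X) := by
  have h : toChainHom c 1 ≫ faceHom c.Chain (fun _ i => c.chainFace i) 0 ≫ aug (c.Chain 0) =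
      faceHom (fun n => C(stdSimplex ℝ (Fin n), X)) (fun _ i => singFace G X i) 0 ≫ aug _ := by
    rw [← Category.assoc, toChainHom_faceHom, Category.assoc, toChainHom_aug]
  exact h

/-- The identity of a projective resolution factors through the complex of chains of cell sets. -/
theorem exists_factorization (c : CellCover G X S) (P : ProjectiveResolution (trivialMod G))
    (hX : ∀ H : Subgroup G, Finite H → ContractibleSpace (MulAction.fixedPoints H X))
    (hc : ∀ n, Projective (freeOn G (c.Chain (n + 1)))) :
    ∃ (φ : P.complex ⟶ faceComplex (chainFace_rel c))
      (ψ : faceComplex (chainFace_rel c) ⟶ P.complex), Nonempty (Homotopy (φ ≫ ψ) (𝟙 _)) := by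
  -- The simplex on no vertices is empty, so there is exactly one singular simplex in degree `-1`.
  have : IsEmpty (stdSimplex ℝ (Fin 0)) := ⟨fun t => by simpa using t.2.2⟩
  have : Subsingleton C(stdSimplex ℝ (Fin 0), X) := ⟨fun f g => by ext t; exact isEmptyElim t⟩
  have : Nonempty C(stdSimplex ℝ (Fin 0), X) := ⟨⟨fun t => isEmptyElim t, by fun_prop⟩⟩
  obtain ⟨he, h0, h1⟩ := faceComplex_exact (singFace_rel G X) fun L => by
    have := hX L.subgroup L.finite
    exact singBd_exact (X := X) L.subgroup
  have : ∀ n, Projective ((faceComplex (chainFace_rel c)).X n) := hc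
  obtain ⟨p, hp, hep, hp0, hpex⟩ : ∃ p : P.complex.X 0 ⟶ trivialMod G, p = P.π.f 0 ∧ Epi p ∧
      ∃ w : P.complex.d 1 0 ≫ p = 0, (ShortComplex.mk _ _ w).Exact :=
    ⟨P.π.f 0, rfl, inferInstanceAs (Epi (P.π.f 0)), P.complex_d_comp_π_f_zero, P.exact₀⟩
  -- `α` uses projectivity of `P` and exactness of singular chains; `ψ` below uses projectivity of
  -- the complex of cell sets and exactness of `P`.
  obtain ⟨α, hα⟩ := @ChainComplex.exists_lift _ _ _ P.complex (faceComplex (singFace_rel G X)) _ _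
    p hp0 (faceAug (singFace_rel G X)) he (faceComplex_d_aug (singFace_rel G X)) h0 h1
  obtain ⟨ψ, hψ⟩ := @ChainComplex.exists_lift _ _ _ (faceComplex (chainFace_rel c)) P.complex _ _
    (faceAug (chainFace_rel c)) (faceComplex_d_aug _) p hep hp0 hpex P.exact_succ
  refine ⟨α ≫ toChainMap c, ψ, ⟨ProjectiveResolution.liftHomotopy (𝟙 _) _ _ ?_ ?_⟩⟩
  · have h2 : ((α ≫ toChainMap c) ≫ ψ).f 0 ≫ p = p := by
      rw [HomologicalComplex.comp_f, HomologicalComplex.comp_f, Category.assoc, hψ, Category.assoc,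
        toChainMap_aug, hα]
    rw [hp] at h2
    rw [CategoryTheory.Functor.map_id, Category.comp_id]
    exact HomologicalComplex.to_single_hom_ext h2
  · rw [CategoryTheory.Functor.map_id, Category.comp_id, Category.id_comp]

end OrbitCat

/-! ### The modules `Q_K` detect the top cohomology -/

namespace OrbitCat

open FreeAbelianGroup FreeChain CellCover Limits ChainComplex

variable {G : Type u} [Group G]

theorem freeEquiv_symm_app (K : OrbitCat G) (M : Mod G) (x : M.obj (Opposite.op K))
    (L : (OrbitCat G)ᵒᵖ) (r : L.unop ⟶ K) :
    (((freeEquiv K M).symm x).app L).hom (of r : FreeAbelianGroup (L.unop ⟶ K)) =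
      (M.map r.op).hom x := by
  obtain ⟨f, rfl⟩ := (freeEquiv K M).surjective x
  rw [Equiv.symm_apply_apply]
  have h1 : ((free K).map r.op).hom (of (𝟙 K) : FreeAbelianGroup (K ⟶ K)) =
      (of r : FreeAbelianGroup (L.unop ⟶ K)) :=
    (map_of_apply _).trans (congrArg of (Category.comp_id r))
  have h2 : freeEquiv K M f = (f.app (Opposite.op K)).hom (of (𝟙 K) : FreeAbelianGroup (K ⟶ K)) :=
    rfl
  rw [h2, ← h1]
  exact congrArg (fun t => t.hom (of (𝟙 K) : FreeAbelianGroup (K ⟶ K))) (f.naturality r.op)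

/-- The object of the orbit category given by a subgroup of a finite subgroup. -/
def sub (K : OrbitCat G) (H : {H : Subgroup G // H < K.subgroup}) : OrbitCat G :=
  ⟨H.1, have := K.finite; Finite.of_injective _ (Subgroup.inclusion_injective H.2.le)⟩

/-- The projection `G/H → G/K` for `H ≤ K`. -/
def subHom (K : OrbitCat G) (H : {H : Subgroup G // H < K.subgroup}) : sub K H ⟶ K :=
  MulAction.homOfFixed _ ((1 : G) : G ⧸ K.subgroup) fun h hh =>
    MulAction.smul_hom_one (MulActionHom.id G) h (H.2.le hh)

theorem card_lt {H K : Subgroup G} [Finite K] (h : H < K) : Nat.card H < Nat.card K :=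
  Set.ncard_lt_ncard h (Set.toFinite (K : Set G))

theorem card_map_conj (H : Subgroup G) (g : G) :
    Nat.card (H.map (MulAut.conj g).toMonoidHom) = Nat.card H :=
  Nat.card_congr (H.equivMapOfInjective _ (MulAut.conj g).injective).symm.toEquiv

theorem sub_mem (K : OrbitCat G) (H : {H : Subgroup G // H < K.subgroup}) :
    sub K H ∈ properSubconjugates K := by
  refine ⟨1, ?_⟩
  convert H.2
  ext x
  simp [sub]

/-- A map out of a proper subconjugate factors through a proper subgroup. -/
theorem exists_subHom {H K : OrbitCat G} (hH : H ∈ properSubconjugates K) (r : H ⟶ K) :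
    ∃ (H' : {H : Subgroup G // H < K.subgroup}) (s : H ⟶ sub K H'), s ≫ subHom K H' = r := by
  have := K.finite
  obtain ⟨g₀, hg₀⟩ := hH
  obtain ⟨g, hg⟩ := QuotientGroup.mk_surjective
    (DFunLike.coe (F := (G ⧸ H.subgroup) →[G] (G ⧸ K.subgroup)) r ((1 : G) : G ⧸ H.subgroup))
  have hle : H.subgroup.map (MulAut.conj g⁻¹).toMonoidHom ≤ K.subgroup := by
    rintro _ ⟨h, hh, rfl⟩
    have h1 := MulAction.smul_hom_one (r : (G ⧸ H.subgroup) →[G] (G ⧸ K.subgroup)) h hh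
    rw [← hg] at h1
    have h2 := QuotientGroup.eq.1 h1.symm
    simpa [mul_assoc] using h2
  -- The conjugating element `g` comes from `r` and may differ from `g₀`, so properness is read off
  -- from the orders.
  have hlt : H.subgroup.map (MulAut.conj g⁻¹).toMonoidHom < K.subgroup := by
    refine lt_of_le_of_ne hle fun h => ?_
    have h1 := card_lt hg₀
    rw [card_map_conj, ← card_map_conj _ g⁻¹, h] at h1
    exact h1.ne rfl
  refine ⟨⟨_, hlt⟩, MulAction.homOfFixed _
    (g : G ⧸ H.subgroup.map (MulAut.conj g⁻¹).toMonoidHom) fun h hh => ?_, ?_⟩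
  · refine Eq.symm (QuotientGroup.eq.2 ⟨h, hh, ?_⟩)
    simp [mul_assoc]
  · refine hom_eq_of_apply_eq (Ω := G ⧸ H.subgroup) ((1 : G) : G ⧸ H.subgroup) (Eq.trans ?_ hg)
    show ((1 : G) * g) • (((1 : G) : G ⧸ K.subgroup)) = _
    rw [one_mul]
    exact congrArg QuotientGroup.mk (mul_one g)

instance (K : OrbitCat G) : Finite {H : Subgroup G // H < K.subgroup} := by
  have := K.finite
  refine Finite.of_injective (fun H => H.1.subgroupOf K.subgroup) fun H H' h => Subtype.ext ?_
  have h1 := congrArg (Subgroup.map K.subgroup.subtype) h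
  rwa [Subgroup.map_subgroupOf_eq_of_le H.2.le, Subgroup.map_subgroupOf_eq_of_le H'.2.le] at h1

instance (K : OrbitCat G) (F : {H : Subgroup G // H < K.subgroup} → Mod G) : HasBiproduct F := by
  have : HasFiniteBiproducts (Mod G) := Abelian.hasFiniteBiproducts
  infer_instance

/-- A generator of the submodule `N_K`. -/
noncomputable def genHom (K : OrbitCat G) (H : {H : Subgroup G // H < K.subgroup}) :
    free (sub K H) ⟶ N K :=
  (freeEquiv _ _).symm ⟨(of (subHom K H) : FreeAbelianGroup (sub K H ⟶ K)),
    AddSubgroup.subset_closure ⟨sub K H, sub_mem K H, 𝟙 _, (of (subHom K H) :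
      FreeAbelianGroup (sub K H ⟶ K)), ((map_of_apply _).trans
        (congrArg of (Category.id_comp (subHom K H)))).symm⟩⟩

theorem genHom_of (K : OrbitCat G) (H : {H : Subgroup G // H < K.subgroup}) (L : (OrbitCat G)ᵒᵖ)
    (s : L.unop ⟶ sub K H) :
    ((genHom K H ≫ Nι K).app L).hom (of s : FreeAbelianGroup (L.unop ⟶ sub K H)) =
      (of (s ≫ subHom K H) : FreeAbelianGroup (L.unop ⟶ K)) := by
  refine (congrArg ((Nι K).app L).hom (freeEquiv_symm_app _ _ _ _ _)).trans ?_
  exact map_of_apply _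

/-- The submodule `N_K` is a quotient of a finite sum of free modules on smaller subgroups. -/
theorem epi_genHom (K : OrbitCat G) : Epi (biproduct.desc (genHom K)) := by
  refine mod_epi _ fun L y => ?_
  have key : generatedAt (free K) (properSubconjugates K) L ≤
      AddMonoidHom.range ((biproduct.desc (genHom K) ≫ Nι K).app L).hom := by
    refine (AddSubgroup.closure_le _).2 ?_
    rintro _ ⟨H, hH, r, x, rfl⟩
    let A : AddSubgroup (FreeAbelianGroup (H ⟶ K)) :=
      (AddMonoidHom.range ((biproduct.desc (genHom K) ≫ Nι K).app L).hom).comap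
        ((free K).map r.op).hom
    show x ∈ A
    induction x using FreeAbelianGroup.induction_on with
    | zero => exact zero_mem A
    | of χ =>
      obtain ⟨H', s, rfl⟩ := exists_subHom hH χ
      refine ⟨((biproduct.ι (fun H => free (sub K H)) H').app L).hom
        (of (r ≫ s) : FreeAbelianGroup (L.unop ⟶ sub K H')), ?_⟩
      have h1 : biproduct.ι (fun H => free (sub K H)) H' ≫ biproduct.desc (genHom K) ≫ Nι K =
          genHom K H' ≫ Nι K := by
        rw [← Category.assoc, biproduct.ι_desc]
      refine (congrArg (fun t : free (sub K H') ⟶ free K => (t.app L).hom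
        (of (r ≫ s) : FreeAbelianGroup (L.unop ⟶ sub K H'))) h1).trans ?_
      refine (genHom_of K H' L (r ≫ s)).trans ?_
      refine Eq.trans ?_ (map_of_apply _).symm
      exact congrArg of (Category.assoc _ _ _)
    | neg χ h => exact neg_mem h
    | add x y hx hy => exact add_mem hx hy
  obtain ⟨z, hz⟩ := key y.2
  exact ⟨z, Subtype.ext hz⟩

instance (K : OrbitCat G) : Mono (Nι K) := by
  have : ∀ L, Mono ((Nι K).app L) := fun L =>
    (AddCommGrpCat.mono_iff_injective _).2 Subtype.val_injective
  exact NatTrans.mono_of_mono_app _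

/-- If the top cohomology vanishes on all `Q_K`, it vanishes on all `P_K`. -/
theorem cohomologyVanishes_free {P : ChainComplex (Mod G) ℕ} [∀ i, Projective (P.X i)] {n : ℕ}
    (hQ : ∀ K : OrbitCat G, CohomologyVanishes P n (Q K))
    (h : ∀ M, CohomologyVanishes P (n + 1) M) (K : OrbitCat G) :
    CohomologyVanishes P n (free K) := by
  induction hk : Nat.card K.subgroup using Nat.strong_induction_on generalizing K with
  | _ k ih =>
    have := K.finite
    -- By induction cohomology vanishes on the summands `P_H` with `H < K`; right exactness in top
    -- degree passes this to their quotient `N_K`.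
    have hN : CohomologyVanishes P n (N K) := by
      have := epi_genHom K
      refine CohomologyVanishes.of_epi (biproduct.desc (genHom K)) ?_ (h _)
      intro w hw
      choose t ht using fun H => ih _ (hk ▸ card_lt H.2) (sub K H) rfl (w ≫ biproduct.π _ H)
        (by rw [← Category.assoc, hw, zero_comp])
      exact ⟨biproduct.lift t, biproduct.hom_ext _ _ fun H => by
        rw [Category.assoc, biproduct.lift_π, ht]⟩
    let S : ShortComplex (Mod G) :=
      ShortComplex.mk (Nι K) (cokernel.π (Nι K)) (cokernel.condition _)
    have hS : S.ShortExact :=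
      { exact := ShortComplex.exact_cokernel _
        mono_f := inferInstanceAs (Mono (Nι K))
        epi_g := inferInstanceAs (Epi (cokernel.π (Nι K))) }
    exact CohomologyVanishes.of_shortExact hS hN (hQ K)

end OrbitCat

/-! ### Finiteness of the set of chains of cell sets -/

namespace CellCover

variable {G X S : Type*} [Group G] [TopologicalSpace X] [MulAction G X]
  [MulAction G S] (c : CellCover G X S)

/-- The cells meeting a given cell. -/
def star (e : S) : Set S := {e' | ∃ y, e ∈ c.σ y ∧ e' ∈ c.σ y}

/-- The finiteness conditions satisfied by a proper cocompact cell structure. -/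
structure IsFinite : Prop where
  stabilizer (e : S) : Finite (MulAction.stabilizer G e)
  quotient : Finite (MulAction.orbitRel.Quotient G S)
  star (e : S) : (c.star e).Finite

theorem finite_setOf_smul_eq {e : S} (h : Finite (MulAction.stabilizer G e)) (e' : S) :
    {g : G | g • e = e'}.Finite := by
  rcases Set.eq_empty_or_nonempty {g : G | g • e = e'} with h' | ⟨g₀, hg₀⟩
  · rw [h']; exact Set.finite_empty
  · refine ((Set.toFinite (MulAction.stabilizer G e : Set G)).image (g₀ * ·)).subset fun g hg => ?_
    refine ⟨g₀⁻¹ * g, ?_, by simp⟩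
    rw [Set.mem_ofPred_eq] at hg hg₀
    rw [SetLike.mem_coe, MulAction.mem_stabilizer_iff, mul_smul, hg, inv_smul_eq_iff, hg₀]

theorem finite_setOf_smul_mem {e : S} (h : Finite (MulAction.stabilizer G e)) {A : Set S}
    (hA : A.Finite) : {g : G | g • e ∈ A}.Finite := by
  have : {g : G | g • e ∈ A} = ⋃ e' ∈ A, {g : G | g • e = e'} := by ext; simp
  rw [this]
  exact hA.biUnion fun e' _ => finite_setOf_smul_eq h e'

variable {c}

/-- The last set is the smallest, so `e` lies in every set of the chain. -/
theorem Chain.subset_star {n : ℕ} (s : c.Chain (n + 1)) {e : S} (he : e ∈ s.1 (Fin.last n))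
    (k : Fin (n + 1)) : s.1 k ⊆ c.star e := by
  obtain ⟨-, y, hy⟩ := s.2.2 k
  exact fun e' he' => ⟨y, hy (s.2.1.antitone (Fin.le_last k) he), hy he'⟩

/-- An element fixing the chain moves `e` into the finite star of `e`, and only finitely many group
elements do so. -/
theorem Chain.finite_stabilizer (hc : c.IsFinite) {n : ℕ} (s : c.Chain (n + 1)) :
    Finite (MulAction.stabilizer G s) := by
  obtain ⟨e, he⟩ := (s.2.2 (Fin.last n)).1
  refine (finite_setOf_smul_mem (hc.stabilizer e) (hc.star e)).subset fun g hg => ?_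
  refine Chain.subset_star s he (Fin.last n) ?_
  have h : g • s = s := hg
  have h1 : g • s.1 (Fin.last n) = s.1 (Fin.last n) := by rw [← Chain.smul_val, h]
  rw [← h1]
  exact Set.smul_mem_smul_set he

/-- Up to translation, the last member of a chain contains a given representative. -/
theorem Chain.exists_smul {n : ℕ} (s : c.Chain (n + 1)) :
    ∃ (j : MulAction.orbitRel.Quotient G S) (g : G), j.out ∈ (g • s).1 (Fin.last n) := by
  obtain ⟨e, he⟩ := (s.2.2 (Fin.last n)).1
  let j : MulAction.orbitRel.Quotient G S := Quotient.mk'' e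
  have h1 : MulAction.orbitRel G S j.out e := Quotient.exact' (Quotient.out_eq' j)
  obtain ⟨g, hg⟩ := h1
  refine ⟨j, g, ?_⟩
  rw [← hg, Chain.smul_val]
  exact Set.smul_mem_smul_set he

/-- Up to translation the smallest set contains one of finitely many representatives, so all sets of
the chain lie in one of finitely many finite stars. -/
theorem Chain.finite_quotient (hc : c.IsFinite) (n : ℕ) :
    Finite (MulAction.orbitRel.Quotient G (c.Chain (n + 1))) := by
  have := hc.quotient
  let U : MulAction.orbitRel.Quotient G S → Set (c.Chain (n + 1)) :=
    fun j => {s | j.out ∈ s.1 (Fin.last n)}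
  have hU : ∀ j, (U j).Finite := fun j => by
    have h1 : {f : Fin (n + 1) → Set S | ∀ k, f k ∈ 𝒫 (c.star j.out)}.Finite :=
      Set.Finite.pi' fun _ => (hc.star j.out).powerset
    refine (h1.preimage (f := Subtype.val) Subtype.val_injective.injOn).subset fun s hs k => ?_
    exact Chain.subset_star s hs k
  have hfin : (⋃ j, U j).Finite := Set.finite_iUnion hU
  refine Set.finite_univ_iff.1 ((hfin.image (Quotient.mk'' :
    _ → MulAction.orbitRel.Quotient G (c.Chain (n + 1)))).subset fun q _ => ?_)
  induction q using Quotient.inductionOn' with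
  | h s =>
    obtain ⟨j, g, h⟩ := Chain.exists_smul s
    exact ⟨g • s, Set.mem_iUnion.2 ⟨j, h⟩, Quotient.sound' ⟨g, rfl⟩⟩

theorem Chain.exists_isEmpty (hc : c.IsFinite) : ∃ B, ∀ n, B ≤ n → IsEmpty (c.Chain (n + 1)) := by
  have := hc.quotient
  have := Fintype.ofFinite (MulAction.orbitRel.Quotient G S)
  -- A strict chain whose last set contains the representative of `j` consists of distinct subsets
  -- of its star, so its length is at most `b j`.
  let b : MulAction.orbitRel.Quotient G S → ℕ := fun j => (𝒫 (c.star j.out)).ncard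
  refine ⟨∑ j, b j, fun n hn => ⟨fun s => ?_⟩⟩
  obtain ⟨j, g, h⟩ := Chain.exists_smul s
  have hinj : Function.Injective (g • s).1 := (g • s).2.1.injective
  have h1 : n + 1 ≤ b j := by
    have h2 : Set.range (g • s).1 ⊆ 𝒫 (c.star j.out) := by
      rintro _ ⟨k, rfl⟩
      exact Chain.subset_star (g • s) h k
    have h3 := Set.ncard_le_ncard h2 (hc.star j.out).powerset
    rwa [← Set.image_univ, Set.ncard_image_of_injective _ hinj, Set.ncard_univ,
      Nat.card_eq_fintype_card, Fintype.card_fin] at h3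
  have h4 : b j ≤ ∑ j, b j := Finset.single_le_sum (fun _ _ => Nat.zero_le _) (Finset.mem_univ j)
  omega

end CellCover

/-! ### The dimension of a group with a proper cocompact cell structure -/

namespace OrbitCat

open FreeAbelianGroup FreeChain CellCover Limits ChainComplex

variable {G : Type u} [Group G]

theorem isZero_freeOn (T : Type u) [MulAction G T] [IsEmpty T] : IsZero (freeOn G T) := by
  rw [IsZero.iff_id_eq_zero]
  exact freeOn_hom_ext fun L s => isEmptyElim (s ((1 : G) : G ⧸ L.unop.subgroup))

theorem not_isZero_trivialMod : ¬ IsZero (trivialMod G) := by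
  intro h
  let L : OrbitCat G := ⟨⊥, inferInstance⟩
  have h1 := (Functor.isZero_iff _).1 h (Opposite.op L)
  have h2 := AddCommGrpCat.subsingleton_of_isZero h1
  have h3 := h2.elim (ULift.up (0 : ℤ) : ULift.{u} ℤ) (ULift.up (1 : ℤ) : ULift.{u} ℤ)
  exact absurd (congrArg ULift.down h3) zero_ne_one

theorem not_cohomologyVanishes_zero (P : ProjectiveResolution (trivialMod G)) :
    ¬ CohomologyVanishes P.complex 0 (trivialMod G) := by
  intro h
  obtain ⟨p, hep, hp⟩ : ∃ p : P.complex.X 0 ⟶ trivialMod G, Epi p ∧ P.complex.d 1 0 ≫ p = 0 :=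
    ⟨P.π.f 0, inferInstanceAs (Epi (P.π.f 0)), P.complex_d_comp_π_f_zero⟩
  obtain ⟨t, ht⟩ := h p hp
  -- In degree 0 `next` returns 0 and the differential is zero, so vanishing would force the
  -- augmentation to be zero.
  rw [P.complex.shape _ _ (by simp), zero_comp] at ht
  refine not_isZero_trivialMod (G := G) ((IsZero.iff_id_eq_zero _).2 ?_)
  rw [← cancel_epi p, ← ht, zero_comp, zero_comp]

/-- The main theorem for groups acting on a space with a suitable cover by cells. -/
theorem bredonDim_eq_sSup_of_cellCover {X S : Type u} [TopologicalSpace X] [MulAction G X]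
    [ContinuousConstSMul G X] [MulAction G S] (c : CellCover G X S) (hc : c.IsFinite)
    (hX : ∀ H : Subgroup G, Finite H → ContractibleSpace (MulAction.fixedPoints H X)) :
    bredonDim G =
      sSup {d : WithBot ℕ∞ | ∃ n : ℕ, d = ((n : ℕ∞) : WithBot ℕ∞) ∧
        ∃ K : OrbitCat G, Nontrivial (bredonCohomology n (Q K))} := by
  have hfree : ∀ n, IsFinFree (freeOn G (c.Chain (n + 1))) := fun n => by
    have := Chain.finite_quotient hc n
    exact isFinFree_freeOn fun s => Chain.finite_stabilizer hc s
  let P := projectiveResolution (trivialMod G)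
  obtain ⟨φ, ψ, ⟨h⟩⟩ := exists_factorization c P hX fun n => (hfree n).projective
  have hbdd : ∃ B, ∀ n, B ≤ n → ∀ M, CohomologyVanishes P.complex n M := by
    obtain ⟨B, hB⟩ := Chain.exists_isEmpty hc
    refine ⟨B, fun n hn M => CohomologyVanishes.of_homotopy h (cohomologyVanishes_of_isZero ?_ M)⟩
    have := hB n hn
    exact isZero_freeOn (c.Chain (n + 1))
  classical
  -- The least vanishing bound is positive because degree 0 cohomology of the constant module is
  -- non-zero; its predecessor `d` is the top degree.
  obtain ⟨d, hd⟩ : ∃ d, Nat.find hbdd = d + 1 := by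
    refine Nat.exists_eq_succ_of_ne_zero fun h0 => ?_
    have h1 := Nat.find_spec hbdd
    rw [h0] at h1
    exact not_cohomologyVanishes_zero P (h1 0 le_rfl _)
  have hvan : ∀ n, d + 1 ≤ n → ∀ M, CohomologyVanishes P.complex n M := by
    have h1 := Nat.find_spec hbdd
    rwa [hd] at h1
  have hex : ∃ K : OrbitCat G, ¬ CohomologyVanishes P.complex d (Q K) := by
    by_contra! hQ
    have hK := cohomologyVanishes_free hQ (hvan (d + 1) le_rfl)
    obtain ⟨J, _, K, π, ι, hid⟩ := hfree d
    -- Vanishing on all `P_K` gives vanishing on the degree `d` term of the complex of cell sets,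
    -- which detects all coefficients and contradicts minimality.
    have hD : CohomologyVanishes P.complex d ((faceComplex (chainFace_rel c)).X d) :=
      CohomologyVanishes.of_sum π ι hid fun j => hK (K j)
    have hM := CohomologyVanishes.of_terms h hD (hvan (d + 1) le_rfl)
    refine Nat.find_min hbdd (m := d) (by omega) fun n hn M => ?_
    rcases hn.eq_or_lt with rfl | hn
    · exact hM M
    · exact hvan n hn M
  obtain ⟨K, hK⟩ := hex
  have h1 : IsLeast {e : WithBot ℕ∞ | ∃ n : ℕ, e = ((n : ℕ∞) : WithBot ℕ∞) ∧
      ∃ R : ProjectiveResolution (trivialMod G), ∀ i, n < i → IsZero (R.complex.X i)}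
      ((d : ℕ∞) : WithBot ℕ∞) := by
    refine ⟨⟨d, rfl, ProjectiveResolution.min _, ProjectiveResolution.isZero_min _ d
      fun M => ?_⟩, ?_⟩
    · exact CohomologyVanishes.of_homotopy
        (ProjectiveResolution.homotopyEquiv (ProjectiveResolution.min _) P).homotopyHomInvId
        (hvan (d + 1) le_rfl M)
    · rintro _ ⟨n, rfl, R, hR⟩
      have : d ≤ n := by
        by_contra! hlt
        exact hK (CohomologyVanishes.of_homotopy
          (ProjectiveResolution.homotopyEquiv P R).homotopyHomInvId
          (cohomologyVanishes_of_isZero (hR d hlt) _))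
      exact_mod_cast this
  have h2 : IsGreatest {e : WithBot ℕ∞ | ∃ n : ℕ, e = ((n : ℕ∞) : WithBot ℕ∞) ∧
      ∃ K : OrbitCat G, Nontrivial (bredonCohomology n (Q K))} ((d : ℕ∞) : WithBot ℕ∞) := by
    refine ⟨⟨d, rfl, K, (nontrivial_homology_linearYonedaObj_iff d _).2 hK⟩, ?_⟩
    rintro _ ⟨n, rfl, K', hK'⟩
    have h3 := (nontrivial_homology_linearYonedaObj_iff n _).1 hK'
    have : n ≤ d := by
      by_contra! hlt
      exact h3 (hvan n hlt _)
    exact_mod_cast this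
  exact h1.csInf_eq.trans h2.csSup_eq.symm

end OrbitCat

/-! ### The cover of a `G`-CW-complex by its closed cells -/

theorem Topology.RelCWComplex.exists_finite_cover {X : Type*} [TopologicalSpace X] {D : Set X}
    [Topology.CWComplex D] (n : ℕ) (i : Topology.RelCWComplex.cell D n) :
    ∃ A : Set (Σ n, Topology.RelCWComplex.cell D n), A.Finite ∧
      Topology.RelCWComplex.closedCell n i ⊆
        ⋃ e' ∈ A, Topology.RelCWComplex.openCell e'.1 e'.2 := by
  obtain ⟨I, hI⟩ := Topology.CWComplex.cellFrontier_subset_finite_openCell n i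
  have hfin : (insert ⟨n, i⟩ (⋃ m ∈ Finset.range n, Sigma.mk m '' (I m : Set _))).Finite := by
    refine Set.Finite.insert _ ?_
    refine (Finset.finite_toSet (Finset.range n)).biUnion fun m _ => ?_
    exact (Finset.finite_toSet (I m)).image _
  refine ⟨_, hfin, ?_⟩
  rw [← Topology.RelCWComplex.cellFrontier_union_openCell_eq_closedCell]
  refine Set.union_subset (hI.trans ?_) ?_
  · refine Set.iUnion₂_subset fun m hm => Set.iUnion₂_subset fun j hj => ?_
    refine Set.subset_biUnion_of_mem
      (u := fun e : Σ n, Topology.RelCWComplex.cell D n => Topology.RelCWComplex.openCell e.1 e.2)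
      (x := ⟨m, j⟩) (Set.mem_insert_of_mem _ (Set.mem_iUnion₂.2 ⟨m, ?_, ?_⟩))
    · exact Finset.mem_range.2 hm
    · exact Set.mem_image_of_mem _ hj
  · exact Set.subset_biUnion_of_mem
      (u := fun e : Σ n, Topology.RelCWComplex.cell D n => Topology.RelCWComplex.openCell e.1 e.2)
      (x := ⟨n, i⟩) (Set.mem_insert _ _)

namespace GCWStructure

open Metric Set Topology

variable {G : Type u} {X : Type v} [Group G] [TopologicalSpace X] [MulAction G X]
  (C : GCWStructure G X)

/-- The cells of all dimensions. -/
def Cell : Type v := Σ n, C.cell n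

instance : MulAction G C.Cell where
  smul g e := ⟨e.1, (C.cellAction e.1).toSMul.smul g e.2⟩
  one_smul e := Sigma.ext rfl (heq_of_eq ((C.cellAction e.1).one_smul e.2))
  mul_smul g h e := Sigma.ext rfl (heq_of_eq ((C.cellAction e.1).mul_smul g h e.2))

/-- The center of a cell. -/
def center (e : C.Cell) : X := C.map e.1 e.2 0

/-- The open cells. -/
def opened (e : C.Cell) : Set X := C.map e.1 e.2 '' ball 0 1

/-- The closed cells. -/
def closed (e : C.Cell) : Set X := C.map e.1 e.2 '' closedBall 0 1

variable {C}

theorem center_mem_opened (e : C.Cell) : C.center e ∈ C.opened e :=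
  ⟨0, by simp, rfl⟩

theorem center_smul (g : G) (e : C.Cell) : C.center (g • e) = g • C.center e :=
  C.map_smul e.1 g e.2 0 (by simp)

theorem closed_smul (g : G) (e : C.Cell) : C.closed (g • e) = g • C.closed e := by
  ext x
  constructor
  · rintro ⟨p, hp, rfl⟩
    exact ⟨_, ⟨p, hp, rfl⟩, (C.map_smul e.1 g e.2 p hp).symm⟩
  · rintro ⟨_, ⟨p, hp, rfl⟩, rfl⟩
    exact ⟨p, hp, C.map_smul e.1 g e.2 p hp⟩

theorem opened_smul (g : G) (e : C.Cell) : C.opened (g • e) = g • C.opened e := by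
  ext x
  constructor
  · rintro ⟨p, hp, rfl⟩
    exact ⟨_, ⟨p, hp, rfl⟩, (C.map_smul e.1 g e.2 p (ball_subset_closedBall hp)).symm⟩
  · rintro ⟨_, ⟨p, hp, rfl⟩, rfl⟩
    exact ⟨p, hp, C.map_smul e.1 g e.2 p (ball_subset_closedBall hp)⟩

theorem eq_of_mem_opened {e e' : C.Cell} {x : X} (h : x ∈ C.opened e) (h' : x ∈ C.opened e') :
    e = e' := by
  by_contra hne
  exact Set.disjoint_left.1 (C.pairwiseDisjoint' (mem_univ e) (mem_univ e') hne) h h'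

theorem exists_mem_closed (x : X) : ∃ e, x ∈ C.closed e := by
  have h : x ∈ ⋃ (n : ℕ) (j : C.cell n), C.map n j '' closedBall 0 1 := by
    rw [C.union']; trivial
  obtain ⟨n, j, hx⟩ := by simpa only [mem_iUnion] using h
  exact ⟨⟨n, j⟩, hx⟩

variable (C) in
/-- The open cells meeting a closed cell. -/
def inside (e : C.Cell) : Set C.Cell := {e' | (C.opened e' ∩ C.closed e).Nonempty}

theorem exists_finite_cover (e : C.Cell) :
    ∃ A : Set C.Cell, A.Finite ∧ C.closed e ⊆ ⋃ e' ∈ A, C.opened e' :=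
  @RelCWComplex.exists_finite_cover X _ _ C.toCWComplex e.1 e.2

theorem exists_mem_opened (x : X) : ∃ e, x ∈ C.opened e := by
  obtain ⟨e, he⟩ := exists_mem_closed (C := C) x
  obtain ⟨A, -, hA⟩ := exists_finite_cover e
  obtain ⟨e', -, h⟩ := mem_iUnion₂.1 (hA he)
  exact ⟨e', h⟩

theorem finite_inside (e : C.Cell) : (C.inside e).Finite := by
  obtain ⟨A, hA, h⟩ := exists_finite_cover e
  refine hA.subset ?_
  rintro e' ⟨x, hx, hx'⟩
  obtain ⟨e'', h1, h2⟩ := mem_iUnion₂.1 (h hx')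
  rwa [eq_of_mem_opened hx h2]

theorem inside_smul (g : G) (e : C.Cell) : C.inside (g • e) = g • C.inside e := by
  ext e'
  rw [mem_smul_set_iff_inv_smul_mem]
  constructor
  · rintro ⟨x, hx, hx'⟩
    rw [closed_smul, mem_smul_set_iff_inv_smul_mem] at hx'
    exact ⟨g⁻¹ • x, by rw [opened_smul]; exact smul_mem_smul_set hx, hx'⟩
  · rintro ⟨x, hx, hx'⟩
    rw [opened_smul, mem_inv_smul_set_iff] at hx
    exact ⟨g • x, hx, by rw [closed_smul]; exact smul_mem_smul_set hx'⟩

theorem isClosed_of_finite_inter [T2Space X] {A : Set X}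
    (h : ∀ e, IsClosed (A ∩ C.closed e)) : IsClosed A :=
  C.closed' A (subset_univ A) fun n j => h ⟨n, j⟩

theorem isClosed_closed [T2Space X] (e : C.Cell) : IsClosed (C.closed e) :=
  ((isCompact_closedBall _ _).image_of_continuousOn (C.continuousOn e.1 e.2)).isClosed

/-- Any set of centers of cells is closed. -/
theorem isClosed_center_image [T2Space X] (B : Set C.Cell) : IsClosed (C.center '' B) := by
  refine isClosed_of_finite_inter (C := C) fun e => Set.Finite.isClosed ?_
  refine ((finite_inside e).image C.center).subset ?_
  rintro _ ⟨⟨e', -, rfl⟩, h⟩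
  exact ⟨e', ⟨_, center_mem_opened e', h⟩, rfl⟩

/-- Taking centers embeds the orbits of cells into the compact orbit space so that every subset of
the image is closed. An infinite image would have an accumulation point, which is impossible. -/
theorem finite_orbits [T2Space X] [CompactSpace (MulAction.orbitRel.Quotient G X)] :
    Finite (MulAction.orbitRel.Quotient G C.Cell) := by
  let f : MulAction.orbitRel.Quotient G C.Cell → MulAction.orbitRel.Quotient G X :=
    Quotient.map' C.center (by
      rintro a b ⟨g, rfl⟩
      exact ⟨g, (center_smul g b).symm⟩)
  have hf : Function.Injective f := by
    intro a b
    induction a using Quotient.inductionOn' with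
    | h a =>
    induction b using Quotient.inductionOn' with
    | h b =>
      intro h
      obtain ⟨g, hg⟩ := Quotient.exact' h
      have hg' : C.center (g • b) = C.center a := (center_smul g b).trans hg
      refine Quotient.sound' ⟨g, ?_⟩
      exact eq_of_mem_opened (center_mem_opened (g • b)) (hg' ▸ center_mem_opened a)
  have hclosed : ∀ B : Set (MulAction.orbitRel.Quotient G C.Cell), IsClosed (f '' B) := by
    intro B
    refine isClosed_coinduced.2 ?_
    convert isClosed_center_image (C := C) (Quotient.mk'' ⁻¹' B) using 1
    ext x
    constructor
    · rintro ⟨b, hb, hx⟩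
      induction b using Quotient.inductionOn' with
      | h b =>
        obtain ⟨g, hg⟩ : MulAction.orbitRel G X x (C.center b) := Quotient.exact' hx.symm
        refine ⟨g • b, ?_, (center_smul g b).trans hg⟩
        have h1 : (Quotient.mk'' (g • b) : MulAction.orbitRel.Quotient G C.Cell) =
            Quotient.mk'' b := Quotient.sound' ⟨g, rfl⟩
        show Quotient.mk'' (g • b) ∈ B
        rw [h1]
        exact hb
    · rintro ⟨e, he, rfl⟩
      exact ⟨_, he, rfl⟩
  have hfin : (range f).Finite := by
    by_contra hinf
    obtain ⟨x, -, hx⟩ := (show (range f).Infinite from hinf).exists_accPt_of_subset_isCompact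
      isCompact_univ (subset_univ _)
    rw [accPt_principal_iff_clusterPt, ← mem_closure_iff_clusterPt] at hx
    have h1 : range f \ {x} = f '' {b | f b ≠ x} := by
      ext y
      constructor
      · rintro ⟨⟨b, rfl⟩, hb⟩
        exact ⟨b, hb, rfl⟩
      · rintro ⟨b, hb, rfl⟩
        exact ⟨⟨b, rfl⟩, hb⟩
    rw [h1, (hclosed _).closure_eq] at hx
    obtain ⟨b, hb, hbx⟩ := hx
    exact hb hbx
  have := hfin.to_subtype
  exact Finite.of_injective_finite_range hf

theorem finite_stabilizer (h : ∀ x : X, Finite (MulAction.stabilizer G x)) (e : C.Cell) :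
    Finite (MulAction.stabilizer G e) := by
  refine (Set.toFinite (MulAction.stabilizer G (C.center e) : Set G)).subset fun g hg => ?_
  have h1 : g • e = e := hg
  show g • C.center e = C.center e
  rw [← center_smul, h1]

variable (C) in
/-- The closed cells meeting a closed cell. -/
def meeting (e : C.Cell) : Set C.Cell := {e' | (C.closed e ∩ C.closed e').Nonempty}

/-- Closed cells that meet share a point of some open cell `e''`. One closed cell involves finitely
many `e''`, and each `e''` meets finitely many closed cells: writing these as translates `g⁻¹ •
j.out`, the element `g` carries `e''` into the finite set `inside j.out`. -/
theorem finite_meeting [Finite (MulAction.orbitRel.Quotient G C.Cell)]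
    (h : ∀ e : C.Cell, Finite (MulAction.stabilizer G e)) (e : C.Cell) : (C.meeting e).Finite := by
  have key : ∀ e'' : C.Cell, {e' | e'' ∈ C.inside e'}.Finite := by
    intro e''
    refine (Set.finite_iUnion fun j : MulAction.orbitRel.Quotient G C.Cell =>
      ((CellCover.finite_setOf_smul_mem (h e'') (finite_inside j.out)).image
        fun g => g⁻¹ • j.out)).subset fun e' he' => ?_
    let j : MulAction.orbitRel.Quotient G C.Cell := Quotient.mk'' e'
    obtain ⟨g, hg⟩ : MulAction.orbitRel G C.Cell j.out e' := Quotient.exact' (Quotient.out_eq' j)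
    refine mem_iUnion.2 ⟨j, g, ?_, ?_⟩
    · show g • e'' ∈ C.inside j.out
      rw [← hg]
      show g • e'' ∈ C.inside (g • e')
      rw [inside_smul]
      exact smul_mem_smul_set he'
    · show g⁻¹ • j.out = e'
      rw [← hg]
      exact inv_smul_smul g e'
  refine ((finite_inside e).biUnion fun e'' _ => key e'').subset ?_
  rintro e' ⟨x, hx, hx'⟩
  obtain ⟨e'', h''⟩ := exists_mem_opened (C := C) x
  exact mem_iUnion₂.2 ⟨e'', ⟨x, h'', hx⟩, x, h'', hx'⟩

variable (C) in
/-- The cover of a `G`-CW-complex by its closed cells. -/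
def cellCover [T2Space X] (h : ∀ e, (C.meeting e).Finite) : CellCover G X C.Cell where
  σ x := {e | x ∈ C.closed e}
  smul g x := by
    ext e
    rw [mem_smul_set_iff_inv_smul_mem]
    show g • x ∈ C.closed e ↔ x ∈ C.closed (g⁻¹ • e)
    rw [closed_smul, mem_inv_smul_set_iff]
  nonempty := exists_mem_closed
  -- The complement is the union of the closed cells not containing `y`. Only finitely many of them
  -- meet a given closed cell, so the union is closed in the weak topology.
  isOpen y := by
    rw [← isClosed_compl_iff]
    have hA : {x | {e | x ∈ C.closed e} ⊆ {e | y ∈ C.closed e}}ᶜ =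
        ⋃ e ∈ {e | y ∉ C.closed e}, C.closed e := by
      ext x
      simp only [mem_compl_iff, mem_ofPred_eq, not_subset, mem_iUnion, exists_prop]
      exact ⟨fun ⟨e, h1, h2⟩ => ⟨e, h2, h1⟩, fun ⟨e, h1, h2⟩ => ⟨e, h2, h1⟩⟩
    rw [hA]
    refine isClosed_of_finite_inter (C := C) fun e' => ?_
    have hB : (⋃ e ∈ {e | y ∉ C.closed e}, C.closed e) ∩ C.closed e' =
        ⋃ e ∈ {e | y ∉ C.closed e} ∩ C.meeting e', C.closed e ∩ C.closed e' := by
      ext x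
      simp only [mem_inter_iff, mem_iUnion, exists_prop, meeting]
      constructor
      · rintro ⟨⟨e, h1, h2⟩, h3⟩
        exact ⟨e, ⟨h1, ⟨x, h3, h2⟩⟩, h2, h3⟩
      · rintro ⟨e, ⟨h1, -⟩, h2, h3⟩
        exact ⟨⟨e, h1, h2⟩, h3⟩
    rw [hB]
    exact ((h e').inter_of_right _).isClosed_biUnion fun e _ =>
      (isClosed_closed e).inter (isClosed_closed e')

end GCWStructure

/-! ### Change of universe -/

namespace CellCover

variable {G X S X' S' : Type*} [Group G] [TopologicalSpace X] [MulAction G X] [MulAction G S]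
  [TopologicalSpace X'] [MulAction G X'] [MulAction G S']

/-- Transport of a cover along an equivariant homeomorphism. -/
def congr (c : CellCover G X S) (f : X' ≃ₜ X) (s : S' ≃ S)
    (hf : ∀ (g : G) x, f (g • x) = g • f x) (hs : ∀ (g : G) e, s (g • e) = g • s e) :
    CellCover G X' S' where
  σ x := s ⁻¹' c.σ (f x)
  smul g x := by
    ext e
    rw [Set.mem_smul_set_iff_inv_smul_mem, Set.mem_preimage, Set.mem_preimage, hf, c.smul, hs,
      Set.mem_smul_set_iff_inv_smul_mem]
  nonempty x := (c.nonempty (f x)).preimage s.surjective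
  isOpen y := by
    convert (c.isOpen (f y)).preimage f.continuous using 1
    ext x
    exact s.surjective.preimage_subset_preimage_iff

theorem IsFinite.congr {c : CellCover G X S} (hc : c.IsFinite) (f : X' ≃ₜ X) (s : S' ≃ S)
    (hf : ∀ (g : G) x, f (g • x) = g • f x) (hs : ∀ (g : G) e, s (g • e) = g • s e) :
    (c.congr f s hf hs).IsFinite where
  stabilizer e := by
    have := hc.stabilizer (s e)
    refine (Set.toFinite (MulAction.stabilizer G (s e) : Set G)).subset fun g hg => ?_
    have h1 : g • e = e := hg
    show g • s e = s e
    rw [← hs, h1]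
  quotient := by
    have := hc.quotient
    refine Finite.of_surjective (α := MulAction.orbitRel.Quotient G S)
      (Quotient.map' s.symm ?_) ?_
    · rintro _ b ⟨g, rfl⟩
      refine ⟨g, s.injective ?_⟩
      show s (g • s.symm b) = s (s.symm (g • b))
      rw [hs, s.apply_symm_apply, s.apply_symm_apply]
    · intro q
      induction q using Quotient.inductionOn' with
      | h e => exact ⟨Quotient.mk'' (s e), congrArg Quotient.mk'' (s.symm_apply_apply e)⟩
  star e := by
    refine ((hc.star (s e)).preimage s.injective.injOn).subset ?_
    rintro e' ⟨y, h1, h2⟩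
    exact ⟨f y, h1, h2⟩

end CellCover

/-- Fixed points correspond under an equivariant homeomorphism. -/
def Homeomorph.fixedPoints {H X X' : Type*} [Monoid H] [TopologicalSpace X] [TopologicalSpace X']
    [MulAction H X] [MulAction H X'] (f : X' ≃ₜ X) (hf : ∀ (g : H) x, f (g • x) = g • f x) :
    MulAction.fixedPoints H X' ≃ₜ MulAction.fixedPoints H X :=
  f.subtype fun x => forall_congr' fun g => by rw [← hf, f.injective.eq_iff]

/-- The cells are covered by finitely many copies of `G`. Smallness allows `X` and its cells to be
moved to the universe of `G`, where the free modules live. -/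
theorem GCWStructure.small_cell {G : Type u} {X : Type v} [Group G] [TopologicalSpace X]
    [MulAction G X] (C : GCWStructure G X) [Finite (MulAction.orbitRel.Quotient G C.Cell)] :
    Small.{u} C.Cell := by
  have : Function.Surjective fun q : MulAction.orbitRel.Quotient G C.Cell × G => q.2 • q.1.out := by
    intro e
    have h1 : MulAction.orbitRel G C.Cell e
        (Quotient.mk'' e : MulAction.orbitRel.Quotient G C.Cell).out :=
      Quotient.exact' (Quotient.out_eq' _).symm
    obtain ⟨g, hg⟩ := h1
    exact ⟨(_, g), hg⟩
  have : Small.{u} (MulAction.orbitRel.Quotient G C.Cell) := Countable.toSmall _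
  exact small_of_surjective ‹Function.Surjective _›

theorem GCWStructure.small {G : Type u} {X : Type v} [Group G] [TopologicalSpace X]
    [MulAction G X] (C : GCWStructure G X) [Small.{u} C.Cell] : Small.{u} X := by
  have : Function.Surjective fun q : Σ e : C.Cell, (Fin e.1 → ℝ) => C.map q.1.1 q.1.2 q.2 := by
    intro x
    obtain ⟨e, p, -, hp⟩ := GCWStructure.exists_mem_closed (C := C) x
    exact ⟨⟨e, p⟩, hp⟩
  exact small_of_surjective this

theorem mainTheorem10 {G : Type u} [Group G] {X : Type v} [TopologicalSpace X] [MulAction G X]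
    (hX : IsCocompactProperModel G X) :
    OrbitCat.bredonDim G =
      sSup {d : WithBot ℕ∞ | ∃ n : ℕ, d = ((n : ℕ∞) : WithBot ℕ∞) ∧
        ∃ K : OrbitCat G, Nontrivial (OrbitCat.bredonCohomology n (OrbitCat.Q K))} := by
  have := hX.t2Space
  have := hX.continuousConstSMul
  have := hX.compact_quotient
  obtain ⟨C⟩ := hX.gcw
  have hquot : Finite (MulAction.orbitRel.Quotient G C.Cell) := C.finite_orbits
  have hstab := C.finite_stabilizer hX.finite_stabilizer
  have hmeet := C.finite_meeting hstab
  let c := C.cellCover hmeet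
  have hc : c.IsFinite :=
    { stabilizer := hstab
      quotient := hquot
      star := fun e => (hmeet e).subset fun e' ⟨y, h1, h2⟩ => ⟨y, h1, h2⟩ }
  have := C.small_cell
  have := C.small
  -- Transport the space and its cells to the universe of `G`, with their actions.
  let f : Shrink.{u} X ≃ₜ X := (Shrink.homeomorph X).symm
  let s : Shrink.{u} C.Cell ≃ C.Cell := (equivShrink _).symm
  have hf : ∀ (g : G) x, f (g • x) = g • f x := fun g x => equivShrink_symm_smul g x
  have hs : ∀ (g : G) x, s (g • x) = g • s x := fun g x => equivShrink_symm_smul g x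
  have : ContinuousConstSMul G (Shrink.{u} X) := ⟨fun g => by
    rw [← f.comp_continuous_iff]
    exact ((continuous_const_smul g).comp f.continuous).congr fun x => (hf g x).symm⟩
  refine OrbitCat.bredonDim_eq_sSup_of_cellCover (c.congr f s hf hs) (hc.congr f s hf hs)
    fun H hH => ?_
  have := hX.contractible_fixedPoints H hH
  exact (f.fixedPoints (H := H) fun g x => hf g x).contractibleSpace
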